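/- Let $p\ge 3$, $n\ge 1$, and let $X\sim N_p(\theta,\sigma^2I_p)$ and $Z\sim N_n(0,\sigma^2I_n)$ be independent, with $\theta\in\mathbb R^p$ and $\sigma^2>0$ both unknown. Consider estimation of $\theta$ under the loss $L(d,\theta,\sigma^2)=\|d-\theta\|^2/\sigma^2$; an estimator (a measurable function of $(X,Z)$) is minimax if its maximal risk over all $(\theta,\sigma^2)$ is the smallest among all estimators. Put $\eta=1/\sigma^2$ and, for real $a,b,e$, consider the (possibly improper) hierarchical prior $$\theta\mid\eta,\lambda\sim N_p\big(0,\eta^{-1}(1-\lambda)\lambda^{-1}I_p\big),\qquad \eta\sim\eta^{e}\ \text{on }(0,\infty),\qquad \lambda\sim\lambda^{a}(1-\lambda)^{b}\ \text{on }(0,1).$$ A generalized Bayes estimator is one that, for almost every data point, has a proper posterior and minimizes the posterior expected loss (with finite minimum). Let $S=\|Z\|^2$, $W=\|X\|^2/S$, and for $w>0$ $$\phi(w)=w\,\frac{\int_0^1\lambda^{p/2+a+1}(1-\lambda)^b(1+w\lambda)^{-p/2-n/2-e-2}\,d\lambda}{\int_0^1\lambda^{p/2+a}(1-\lambda)^b(1+w\lambda)^{-p/2-n/2-e-2}\,d\lambda}.$$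 Let $c(p,n)=2(p-2)/(n+2)$ and $\alpha=(p/2+a+1)/(n/2+e-a)$. Suppose $e>-p/2-n/2-1$. (i) If $$-\frac p2-1<a\le\frac{c(p,n)(n/2+e)-p/2-1}{1+c(p,n)}\quad\text{and}\quad b\ge\min(n/2+e-a-1,\,0),$$ then the estimator $(1-\phi(W)/W)X$ is generalized Bayes with respect to the prior, every generalized Bayes estimator is almost everywhere equal to it and is minimax, and $\phi$ is monotone nondecreasing on $(0,\infty)$. (ii) If $$-\frac p2-1<a<\frac{c(p,n)(n/2+e)-p/2-1}{1+c(p,n)}\quad\text{and}\quad -(n+2)\frac{c(p,n)-\alpha}{4(p+a+1)(\alpha+1)}\le b<\min(0,\,n/2+e-a-1),$$ then the lower bound for $b$ here is greater than $-1$, the estimator $(1-\phi(W)/W)X$ is generalized Bayes with respect to the prior, every generalized Bayes estimator is almost everywhere equal to it and is minimax, $\lim_{w\to\infty}\phi(w)=\alpha$, and $\phi$ is not monotone on $(0,\infty)$ (neither nondecreasing nor nonincreasing). -/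

import Mathlib

open MeasureTheory

noncomputable section

namespace GenBayes

/-- The density at `x` of the normal distribution `N_d(0, v I_d)` with respect to Lebesgue measure
on `ℝ^d` (used for `v > 0`). -/
def isoNormalPDF (d : ℕ) (v : ℝ) (x : EuclideanSpace ℝ (Fin d)) : ℝ :=
  (2 * Real.pi * v) ^ (-(d : ℝ) / 2) * Real.exp (-‖x‖ ^ 2 / (2 * v))

/-- The joint density at `y = (x, z)` of independent `X ∼ N_p(θ, v I_p)` and `Z ∼ N_n(0, v I_n)`,
where `v = σ²`. -/
def likelihood (p n : ℕ) (θ : EuclideanSpace ℝ (Fin p)) (v : ℝ)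
    (y : EuclideanSpace ℝ (Fin p) × EuclideanSpace ℝ (Fin n)) : ℝ :=
  isoNormalPDF p v (y.1 - θ) * isoNormalPDF n v y.2

/-- The sampling distribution of `(X, Z)`. -/
def model (p n : ℕ) (θ : EuclideanSpace ℝ (Fin p)) (v : ℝ) :
    Measure (EuclideanSpace ℝ (Fin p) × EuclideanSpace ℝ (Fin n)) :=
  volume.withDensity fun y => ENNReal.ofReal (likelihood p n θ v y)

/-- The scale invariant quadratic loss `‖d - θ‖² / σ²`, where `v = σ²`. -/
def loss {p : ℕ} (θ : EuclideanSpace ℝ (Fin p)) (v : ℝ) (d : EuclideanSpace ℝ (Fin p)) : ENNReal :=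
  ENNReal.ofReal (‖d - θ‖ ^ 2 / v)

/-- The risk of the estimator `δ` at `(θ, σ²)`, where `v = σ²`; it may be infinite. -/
def risk {p n : ℕ}
    (δ : EuclideanSpace ℝ (Fin p) × EuclideanSpace ℝ (Fin n) → EuclideanSpace ℝ (Fin p))
    (θ : EuclideanSpace ℝ (Fin p)) (v : ℝ) : ENNReal :=
  ∫⁻ y, loss θ v (δ y) ∂(model p n θ v)

/-- The maximal risk over all `θ ∈ ℝ^p` and `σ² > 0`. -/
def maxRisk {p n : ℕ}
    (δ : EuclideanSpace ℝ (Fin p) × EuclideanSpace ℝ (Fin n) → EuclideanSpace ℝ (Fin p)) :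
    ENNReal :=
  ⨆ (θ : EuclideanSpace ℝ (Fin p)) (v : ℝ) (_ : 0 < v), risk δ θ v

/-- `δ` is minimax: its maximal risk is the smallest one among all estimators
(measurable functions of the data). -/
def IsMinimax {p n : ℕ}
    (δ : EuclideanSpace ℝ (Fin p) × EuclideanSpace ℝ (Fin n) → EuclideanSpace ℝ (Fin p)) : Prop :=
  Measurable δ ∧
    ∀ δ' : EuclideanSpace ℝ (Fin p) × EuclideanSpace ℝ (Fin n) → EuclideanSpace ℝ (Fin p),
      Measurable δ' → maxRisk δ ≤ maxRisk δ'

/-- The marginal density of the data at `y` under a (possibly improper) prior on `(θ, η)`,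
where `η = 1 / σ²`. -/
def marginal {p n : ℕ} (π : Measure (EuclideanSpace ℝ (Fin p) × ℝ))
    (y : EuclideanSpace ℝ (Fin p) × EuclideanSpace ℝ (Fin n)) : ENNReal :=
  ∫⁻ t, ENNReal.ofReal (likelihood p n t.1 t.2⁻¹ y) ∂π

/-- The posterior distribution of `(θ, η)` given the data `y`; it is a probability measure
when `marginal π y` is neither `0` nor infinite. -/
def posterior {p n : ℕ} (π : Measure (EuclideanSpace ℝ (Fin p) × ℝ))
    (y : EuclideanSpace ℝ (Fin p) × EuclideanSpace ℝ (Fin n)) :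
    Measure (EuclideanSpace ℝ (Fin p) × ℝ) :=
  (marginal π y)⁻¹ • π.withDensity fun t => ENNReal.ofReal (likelihood p n t.1 t.2⁻¹ y)

/-- The posterior expected loss of the action `d` given the data `y`. -/
def posteriorLoss {p n : ℕ} (π : Measure (EuclideanSpace ℝ (Fin p) × ℝ))
    (y : EuclideanSpace ℝ (Fin p) × EuclideanSpace ℝ (Fin n)) (d : EuclideanSpace ℝ (Fin p)) :
    ENNReal :=
  ∫⁻ t, loss t.1 t.2⁻¹ d ∂(posterior π y)

/-- `δ` is a generalized Bayes estimator with respect to the (possibly improper) prior `π` on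
`(θ, η)`: for almost every data point the posterior is proper, and `δ` minimizes the posterior
expected loss, the minimum being finite. -/
def IsGeneralizedBayes {p n : ℕ} (π : Measure (EuclideanSpace ℝ (Fin p) × ℝ))
    (δ : EuclideanSpace ℝ (Fin p) × EuclideanSpace ℝ (Fin n) → EuclideanSpace ℝ (Fin p)) : Prop :=
  Measurable δ ∧
    ∀ᵐ y : EuclideanSpace ℝ (Fin p) × EuclideanSpace ℝ (Fin n) ∂volume,
      marginal π y ≠ 0 ∧ marginal π y ≠ ⊤ ∧ posteriorLoss π y (δ y) ≠ ⊤ ∧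
        ∀ d : EuclideanSpace ℝ (Fin p), posteriorLoss π y (δ y) ≤ posteriorLoss π y d

/-- The joint hierarchical prior of `(θ, η, λ)`, on `ℝ^p × (0, ∞) × (0, 1)`:
`θ | η, λ ∼ N_p(0, η⁻¹ (1 - λ) λ⁻¹ I_p)`, `η` has density `η ^ e`, and `λ` has density
`λ ^ a (1 - λ) ^ b`. -/
def jointPrior (p : ℕ) (a b e : ℝ) : Measure (EuclideanSpace ℝ (Fin p) × ℝ × ℝ) :=
  (volume.restrict (Set.univ ×ˢ Set.Ioi (0 : ℝ) ×ˢ Set.Ioo (0 : ℝ) 1)).withDensity fun t =>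
    ENNReal.ofReal (isoNormalPDF p (t.2.1⁻¹ * (1 - t.2.2) * t.2.2⁻¹) t.1 *
      t.2.1 ^ e * (t.2.2 ^ a * (1 - t.2.2) ^ b))

/-- The prior of the parameter `(θ, η)` that results from the hierarchical prior. -/
def prior (p : ℕ) (a b e : ℝ) : Measure (EuclideanSpace ℝ (Fin p) × ℝ) :=
  (jointPrior p a b e).map fun t => (t.1, t.2.1)

/-- The shrinkage function `φ(w)`, for `w > 0`: a ratio of two integrals over `λ ∈ (0, 1)`. -/
def phi (p n : ℕ) (a b e w : ℝ) : ℝ :=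
  w * (∫ t in Set.Ioo (0 : ℝ) 1, t ^ ((p : ℝ) / 2 + a + 1) * (1 - t) ^ b *
        (1 + w * t) ^ (-(p : ℝ) / 2 - (n : ℝ) / 2 - e - 2)) /
    ∫ t in Set.Ioo (0 : ℝ) 1, t ^ ((p : ℝ) / 2 + a) * (1 - t) ^ b *
        (1 + w * t) ^ (-(p : ℝ) / 2 - (n : ℝ) / 2 - e - 2)

/-- The estimator `(1 - f(W) / W) X` with `W = ‖X‖² / S` and `S = ‖Z‖²`. -/
def shrinkageEstimator (p n : ℕ) (f : ℝ → ℝ)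
    (y : EuclideanSpace ℝ (Fin p) × EuclideanSpace ℝ (Fin n)) : EuclideanSpace ℝ (Fin p) :=
  (1 - f (‖y.1‖ ^ 2 / ‖y.2‖ ^ 2) / (‖y.1‖ ^ 2 / ‖y.2‖ ^ 2)) • y.1

/-- The constant `c(p, n) = 2 (p - 2) / (n + 2)`. -/
def cBound (p n : ℕ) : ℝ := 2 * ((p : ℝ) - 2) / ((n : ℝ) + 2)

/-- The constant `α = (p/2 + a + 1) / (n/2 + e - a)`. -/
def alpha (p n : ℕ) (a e : ℝ) : ℝ := ((p : ℝ) / 2 + a + 1) / ((n : ℝ) / 2 + e - a)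

end GenBayes

end

/-!
Write `A = p/2 + a` and `N = p/2 + n/2 + e + 2`. Given `η` and `λ = t` the posterior of `θ` is
normal with mean `(1 - t) x`, and integrating out `θ` and `η` leaves the weight
`t^A (1 - t)^b (1 + W t)^(-N)` on `t`. The posterior loss is therefore a quadratic in the action,
minimized at `(1 - m(W)) x` for the mean `m` of `t` under this weight, and `φ(w) = w m(w)`.

Stein's identity in `X` and in `Z` bounds the risk of `(1 - φ(W)/W) X` by that of `X`, which is
`p`, as soon as `(n + 2) φ (φ - c) ≤ 4 w φ' (1 + φ)`; no estimator has maximal risk below `p`,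
because the Bayes risk under the prior `N(0, τ I)` tends to `p` as `τ → ∞`.

Integration by parts turns the integrals into a recurrence and a Riccati equation for `φ`. If
`b ≥ min(n/2 + e - a - 1, 0)`, then `φ` increases to its limit `α ≤ c` and the inequality is clear.
If `b` is negative and smaller than `n/2 + e - a - 1`, then `φ` exceeds `α` somewhere, since
otherwise `w^b φ` would increase and `φ` would be unbounded. Convexity of `x ↦ x^(-N)` limits how
large `φ` and `-w φ'` can then be, and the lower bound on `b` is what keeps the inequality true.
-/

namespace GenBayes

open Set Filter Topology

section HypergeometricIntegrals

/-- The integrand of `hyperInt`, an unnormalized density of the mixing variable `t ∈ (0, 1)`. -/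
noncomputable def hyperWeight (b A N w t : ℝ) : ℝ := t ^ A * (1 - t) ^ b * (1 + w * t) ^ (-N)

/-- Euler's integral for the hypergeometric function, up to a beta function: both the normalizing
constant and the numerator of the shrinkage function `φ` are of this form. -/
noncomputable def hyperInt (b A N w : ℝ) : ℝ := ∫ t in Ioo (0 : ℝ) 1, hyperWeight b A N w t

/-- The mean of `t` under the probability density proportional to `hyperWeight b A N w`. -/
noncomputable def hyperMean (b A N w : ℝ) : ℝ := hyperInt b (A + 1) N w / hyperInt b A N w

/-- The shrinkage function `φ` in the parameters of the hypergeometric integral. -/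
noncomputable def hyperPhi (b A N w : ℝ) : ℝ := w * hyperMean b A N w

/-- The elasticity `-w H'(w) / H(w)` of `H = hyperInt b A N`. -/
noncomputable def hyperElasticity (b A N w : ℝ) : ℝ :=
  N * (w * hyperInt b (A + 1) (N + 1) w) / hyperInt b A N w

variable {b A N w : ℝ}

theorem one_add_mul_pos {t : ℝ} (hw : -1 < w) (ht : t ∈ Icc (0 : ℝ) 1) : 0 < 1 + w * t := by
  nlinarith [ht.1, ht.2, mul_nonneg ht.1 (show 0 ≤ 1 + w by linarith)]

theorem hyperWeight_pos (b A N : ℝ) {t : ℝ} (hw : -1 < w) (ht : t ∈ Ioo (0 : ℝ) 1) :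
    0 < hyperWeight b A N w t := by
  have h₁ := one_add_mul_pos hw (Ioo_subset_Icc_self ht)
  have h₂ : 0 < 1 - t := sub_pos.2 ht.2
  have h₃ := ht.1
  unfold hyperWeight
  positivity

theorem hyperWeight_add_one (b A N w : ℝ) {t : ℝ} (ht : 0 < t) :
    hyperWeight b (A + 1) N w t = t * hyperWeight b A N w t := by
  rw [hyperWeight, hyperWeight, Real.rpow_add_one ht.ne']
  ring

theorem hyperWeight_add_one_left (b A N w : ℝ) {t : ℝ} (ht : t < 1) :
    hyperWeight (b + 1) A N w t = (1 - t) * hyperWeight b A N w t := by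
  rw [hyperWeight, hyperWeight, Real.rpow_add_one (sub_pos.2 ht).ne']
  ring

theorem hyperWeight_eq_one_add_mul (b A N : ℝ) {t : ℝ} (hw : -1 < w) (ht : t ∈ Icc (0 : ℝ) 1) :
    hyperWeight b A N w t = (1 + w * t) * hyperWeight b A (N + 1) w t := by
  have h : (1 + w * t) ^ (-N) = (1 + w * t) ^ (-(N + 1)) * (1 + w * t) := by
    rw [← Real.rpow_add_one (one_add_mul_pos hw ht).ne']
    ring_nf
  rw [hyperWeight, hyperWeight, h]
  ring

theorem integrableOn_betaWeight (hA : -1 < A) (hb : -1 < b) :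
    IntegrableOn (fun t : ℝ => t ^ A * (1 - t) ^ b) (Ioo 0 1) := by
  have hbeta := Complex.betaIntegral_convergent (u := (A + 1 : ℝ)) (v := (b + 1 : ℝ))
    (by rw [Complex.ofReal_re]; linarith) (by rw [Complex.ofReal_re]; linarith)
  rw [intervalIntegrable_iff_integrableOn_Ioo_of_le zero_le_one] at hbeta
  have hre : IntegrableOn _ (Ioo (0 : ℝ) 1) := hbeta.re
  refine hre.congr_fun (fun t ht => ?_) measurableSet_Ioo
  have hcpow (x s : ℝ) (hx : 0 ≤ x) : (x : ℂ) ^ (((s + 1 : ℝ) : ℂ) - 1) = ((x ^ s : ℝ) : ℂ) := by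
    rw [Complex.ofReal_cpow hx]
    push_cast
    ring_nf
  have h := hcpow (1 - t) b (sub_nonneg.2 ht.2.le)
  rw [Complex.ofReal_sub, Complex.ofReal_one] at h
  simp only [hcpow t A ht.1.le, h, ← Complex.ofReal_mul]
  exact Complex.ofReal_re _

theorem continuousOn_hyperWeight (b A N : ℝ) (hw : -1 < w) :
    ContinuousOn (hyperWeight b A N w) (Ioo 0 1) := by
  refine ((continuousOn_id.rpow_const fun t ht => Or.inl ht.1.ne').mul
    (ContinuousOn.rpow_const (by fun_prop) fun t ht => Or.inl (sub_pos.2 ht.2).ne')).mul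
    (ContinuousOn.rpow_const (by fun_prop) fun t ht => Or.inl ?_)
  exact (one_add_mul_pos hw (Ioo_subset_Icc_self ht)).ne'

theorem exists_bound_one_add_mul_rpow (N : ℝ) (hw : -1 < w) :
    ∃ C : ℝ, ∃ s ∈ 𝓝 w, s ⊆ Ioi (-1) ∧ ∀ x ∈ s, ∀ t ∈ Icc (0 : ℝ) 1, |(1 + x * t) ^ (-N)| ≤ C := by
  have hsub : Icc ((w - 1) / 2) (w + 1) ⊆ Ioi (-1) := fun x hx => by
    rw [mem_Ioi]
    linarith [hx.1]
  have hcont : ContinuousOn (fun q : ℝ × ℝ => (1 + q.1 * q.2) ^ (-N)) (Ioi (-1) ×ˢ Icc 0 1) :=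
    ContinuousOn.rpow_const (by fun_prop) fun q hq => Or.inl (one_add_mul_pos hq.1 hq.2).ne'
  obtain ⟨C, hC⟩ := ((isCompact_Icc (a := (w - 1) / 2) (b := w + 1)).prod
    (isCompact_Icc (a := (0 : ℝ)) (b := 1))).exists_bound_of_continuousOn
      (hcont.mono (prod_mono hsub le_rfl))
  exact ⟨C, _, Icc_mem_nhds (by linarith) (by linarith), hsub, fun x hx t ht => hC (x, t) ⟨hx, ht⟩⟩

theorem abs_hyperWeight_le {C t : ℝ} (ht : t ∈ Ioo (0 : ℝ) 1) (hC : |(1 + w * t) ^ (-N)| ≤ C) :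
    |hyperWeight b A N w t| ≤ t ^ A * (1 - t) ^ b * C := by
  have h : 0 ≤ t ^ A * (1 - t) ^ b :=
    mul_nonneg (Real.rpow_nonneg ht.1.le _) (Real.rpow_nonneg (sub_nonneg.2 ht.2.le) _)
  rw [hyperWeight, abs_mul, abs_of_nonneg h]
  exact mul_le_mul_of_nonneg_left hC h

theorem aestronglyMeasurable_hyperWeight (b A N : ℝ) (hw : -1 < w) :
    AEStronglyMeasurable (hyperWeight b A N w) (volume.restrict (Ioo 0 1)) :=
  (continuousOn_hyperWeight b A N hw).aestronglyMeasurable measurableSet_Ioo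

theorem integrableOn_hyperWeight (hA : -1 < A) (hb : -1 < b) (N : ℝ) (hw : -1 < w) :
    IntegrableOn (hyperWeight b A N w) (Ioo 0 1) := by
  obtain ⟨C, s, hs, -, hC⟩ := exists_bound_one_add_mul_rpow N hw
  refine ((integrableOn_betaWeight hA hb).mul_const C).mono'
    (aestronglyMeasurable_hyperWeight b A N hw) ?_
  filter_upwards [ae_restrict_mem measurableSet_Ioo] with t ht
  exact abs_hyperWeight_le ht (hC w (mem_of_mem_nhds hs) t (Ioo_subset_Icc_self ht))

theorem setIntegral_Ioo_pos {f : ℝ → ℝ} {x y : ℝ} (hf : IntegrableOn f (Ioo x y))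
    (hpos : ∀ t ∈ Ioo x y, 0 < f t) (hxy : x < y) : 0 < ∫ t in Ioo x y, f t := by
  rw [← integral_Ioc_eq_integral_Ioo, ← intervalIntegral.integral_of_le hxy.le]
  exact intervalIntegral.intervalIntegral_pos_of_pos_on
    ((intervalIntegrable_iff_integrableOn_Ioo_of_le hxy.le).2 hf) hpos hxy

theorem hyperInt_pos (hA : -1 < A) (hb : -1 < b) (N : ℝ) (hw : -1 < w) : 0 < hyperInt b A N w :=
  setIntegral_Ioo_pos (integrableOn_hyperWeight hA hb N hw)
    (fun _ => hyperWeight_pos b A N hw) one_pos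

theorem hyperInt_strictAnti {A' : ℝ} (hA : -1 < A) (hAA' : A < A') (hb : -1 < b) (N : ℝ)
    (hw : -1 < w) : hyperInt b A' N w < hyperInt b A N w := by
  have i := integrableOn_hyperWeight hA hb N hw
  have i' := integrableOn_hyperWeight (hA.trans hAA') hb N hw
  rw [← sub_pos, hyperInt, hyperInt, ← integral_sub i i']
  refine setIntegral_Ioo_pos (i.sub i') (fun t ht => sub_pos.2 ?_) one_pos
  have hpow := Real.rpow_lt_rpow_of_exponent_gt ht.1 ht.2 hAA'
  have hbase := one_add_mul_pos hw (Ioo_subset_Icc_self ht)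
  have hcompl : 0 < 1 - t := sub_pos.2 ht.2
  unfold hyperWeight
  gcongr

theorem hyperInt_eq_add (hA : -1 < A) (hb : -1 < b) (N : ℝ) (hw : -1 < w) :
    hyperInt b A N w = hyperInt b A (N + 1) w + w * hyperInt b (A + 1) (N + 1) w := by
  simp only [hyperInt]
  rw [← integral_const_mul, ← integral_add (integrableOn_hyperWeight hA hb _ hw)
    ((integrableOn_hyperWeight (by linarith) hb _ hw).const_mul w)]
  refine setIntegral_congr_fun measurableSet_Ioo fun t ht => ?_
  simp only [hyperWeight_eq_one_add_mul b A N hw (Ioo_subset_Icc_self ht),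
    hyperWeight_add_one _ _ _ _ ht.1]
  ring

theorem hyperInt_add_one_left (hA : -1 < A) (hb : -1 < b) (N : ℝ) (hw : -1 < w) :
    hyperInt (b + 1) A N w = hyperInt b A N w - hyperInt b (A + 1) N w := by
  simp only [hyperInt]
  rw [← integral_sub (integrableOn_hyperWeight hA hb _ hw)
    (integrableOn_hyperWeight (by linarith) hb _ hw)]
  refine setIntegral_congr_fun measurableSet_Ioo fun t ht => ?_
  simp only [hyperWeight_add_one_left _ _ _ _ ht.2, hyperWeight_add_one _ _ _ _ ht.1]
  ring

theorem hasDerivAt_hyperWeight_param (b A N : ℝ) {t : ℝ} (hw : -1 < w) (ht : t ∈ Ioo (0 : ℝ) 1) :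
    HasDerivAt (fun x => hyperWeight b A N x t) (-N * hyperWeight b (A + 1) (N + 1) w t) w := by
  have hbase := one_add_mul_pos hw (Ioo_subset_Icc_self ht)
  have hlin : HasDerivAt (fun x : ℝ => 1 + x * t) t w := (hasDerivAt_mul_const t).const_add 1
  refine ((hlin.rpow_const (p := -N) (Or.inl hbase.ne')).const_mul _).congr_deriv ?_
  rw [hyperWeight_add_one _ _ _ _ ht.1, hyperWeight, show -(N + 1) = -N - 1 by ring]
  ring

theorem hasDerivAt_hyperInt (hA : -1 < A) (hb : -1 < b) (N : ℝ) (hw : -1 < w) :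
    HasDerivAt (hyperInt b A N) (-N * hyperInt b (A + 1) (N + 1) w) w := by
  obtain ⟨C, s, hs, hs_gt, hC⟩ := exists_bound_one_add_mul_rpow (N + 1) hw
  refine (hasDerivAt_integral_of_dominated_loc_of_deriv_le (μ := volume.restrict (Ioo (0 : ℝ) 1))
    (F := fun x t => hyperWeight b A N x t)
    (F' := fun x t => -N * hyperWeight b (A + 1) (N + 1) x t)
    (bound := fun t => |N| * (t ^ (A + 1) * (1 - t) ^ b * C)) hs ?_
    (integrableOn_hyperWeight hA hb N hw) ?_ ?_ ?_ ?_).2.congr_deriv (integral_const_mul _ _)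
  · filter_upwards [lt_mem_nhds hw] with x hx
    exact aestronglyMeasurable_hyperWeight b A N hx
  · exact (aestronglyMeasurable_hyperWeight b (A + 1) (N + 1) hw).const_mul _
  · filter_upwards [ae_restrict_mem measurableSet_Ioo] with t ht x hx
    rw [Real.norm_eq_abs, abs_mul, abs_neg]
    exact mul_le_mul_of_nonneg_left
      (abs_hyperWeight_le ht (hC x hx t (Ioo_subset_Icc_self ht))) (abs_nonneg N)
  · exact ((integrableOn_betaWeight (by linarith) hb).mul_const C).const_mul |N|
  · filter_upwards [ae_restrict_mem measurableSet_Ioo] with t ht x hx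
    exact hasDerivAt_hyperWeight_param b A N (hs_gt hx) ht

theorem hasDerivAt_hyperWeight (b A N : ℝ) {t : ℝ} (hw : -1 < w) (ht : t ∈ Ioo (0 : ℝ) 1) :
    HasDerivAt (hyperWeight b A N w)
      (A * hyperWeight b (A - 1) N w t - b * hyperWeight (b - 1) A N w t -
        N * w * hyperWeight b A (N + 1) w t) t := by
  have hbase := one_add_mul_pos hw (Ioo_subset_Icc_self ht)
  have hleft : HasDerivAt (fun t : ℝ => t ^ A) (A * t ^ (A - 1)) t :=
    Real.hasDerivAt_rpow_const (Or.inl ht.1.ne')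
  have hright := ((hasDerivAt_id t).const_sub 1).rpow_const (p := b)
    (Or.inl (sub_pos.2 ht.2).ne')
  have hlast := (((hasDerivAt_id t).const_mul w).const_add 1).rpow_const (p := -N)
    (Or.inl hbase.ne')
  refine ((hleft.fun_mul hright).fun_mul hlast).congr_deriv ?_
  simp only [hyperWeight, id_eq, show -(N + 1) = -N - 1 by ring]
  ring

theorem continuousOn_hyperWeight_Icc (N : ℝ) (hA : 0 ≤ A) (hb : 0 ≤ b) (hw : -1 < w) :
    ContinuousOn (hyperWeight b A N w) (Icc 0 1) :=
  ((continuousOn_id.rpow_const fun _ _ => Or.inr hA).mul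
    (ContinuousOn.rpow_const (by fun_prop) fun _ _ => Or.inr hb)).mul
    (ContinuousOn.rpow_const (by fun_prop) fun _ ht => Or.inl (one_add_mul_pos hw ht).ne')

/-- Integration by parts: `hyperWeight (b + 1) (A + 1) N w` vanishes at both endpoints. -/
theorem hyperInt_parts (hA : -1 < A) (hb : -1 < b) (N : ℝ) (hw : -1 < w) :
    (A + 1) * hyperInt (b + 1) A N w =
      (b + 1) * hyperInt b (A + 1) N w + N * w * hyperInt (b + 1) (A + 1) (N + 1) w := by
  have i₁ := (integrableOn_hyperWeight (b := b + 1) hA (by linarith) N hw).const_mul (A + 1)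
  have i₂ := (integrableOn_hyperWeight (A := A + 1) (by linarith) hb N hw).const_mul (b + 1)
  have i₃ := (integrableOn_hyperWeight (b := b + 1) (A := A + 1) (by linarith) (by linarith)
    (N + 1) hw).const_mul (N * w)
  have hftc := intervalIntegral.integral_eq_sub_of_hasDerivAt_of_le zero_le_one
    (continuousOn_hyperWeight_Icc (A := A + 1) (b := b + 1) N (by linarith) (by linarith) hw)
    (fun t ht => hasDerivAt_hyperWeight (b + 1) (A + 1) N hw ht) <| by
      simp only [add_sub_cancel_right]
      exact (intervalIntegrable_iff_integrableOn_Ioo_of_le zero_le_one).2 ((i₁.sub i₂).sub i₃)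
  have h₀ : hyperWeight (b + 1) (A + 1) N w 0 = 0 := by
    simp [hyperWeight, Real.zero_rpow (show A + 1 ≠ 0 by linarith)]
  have h₁ : hyperWeight (b + 1) (A + 1) N w 1 = 0 := by
    simp [hyperWeight, Real.zero_rpow (show b + 1 ≠ 0 by linarith)]
  simp only [add_sub_cancel_right] at hftc
  rw [h₀, h₁, sub_zero, intervalIntegral.integral_of_le zero_le_one, integral_Ioc_eq_integral_Ioo,
    integral_sub (by exact i₁.sub i₂) i₃, integral_sub i₁ i₂, integral_const_mul,
    integral_const_mul, integral_const_mul] at hftc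
  unfold hyperInt
  linarith

theorem hyperMean_pos (hA : -1 < A) (hb : -1 < b) (N : ℝ) (hw : -1 < w) :
    0 < hyperMean b A N w :=
  div_pos (hyperInt_pos (by linarith) hb N hw) (hyperInt_pos hA hb N hw)

theorem hyperMean_lt_one (hA : -1 < A) (hb : -1 < b) (N : ℝ) (hw : -1 < w) :
    hyperMean b A N w < 1 :=
  (div_lt_one (hyperInt_pos hA hb N hw)).2 (hyperInt_strictAnti hA (by linarith) hb N hw)

theorem hyperMean_mul_hyperInt (hA : -1 < A) (hb : -1 < b) (N : ℝ) (hw : -1 < w) :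
    hyperMean b A N w * hyperInt b A N w = hyperInt b (A + 1) N w :=
  div_mul_cancel₀ _ (hyperInt_pos hA hb N hw).ne'

theorem hyperPhi_mul_hyperInt (hA : -1 < A) (hb : -1 < b) (N : ℝ) (hw : -1 < w) :
    hyperPhi b A N w * hyperInt b A N w = w * hyperInt b (A + 1) N w := by
  rw [hyperPhi, mul_assoc, hyperMean_mul_hyperInt hA hb N hw]

theorem hyperElasticity_mul_hyperInt (hA : -1 < A) (hb : -1 < b) (N : ℝ) (hw : -1 < w) :
    hyperElasticity b A N w * hyperInt b A N w = N * (w * hyperInt b (A + 1) (N + 1) w) :=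
  div_mul_cancel₀ _ (hyperInt_pos hA hb N hw).ne'

theorem hyperPhi_pos (hA : -1 < A) (hb : -1 < b) (N : ℝ) (hw : 0 < w) : 0 < hyperPhi b A N w :=
  mul_pos hw (hyperMean_pos hA hb N (by linarith))

theorem hyperPhi_lt_self (hA : -1 < A) (hb : -1 < b) (N : ℝ) (hw : 0 < w) :
    hyperPhi b A N w < w :=
  mul_lt_of_lt_one_right hw (hyperMean_lt_one hA hb N (by linarith))

theorem one_add_mul_hyperElasticity (hA : -1 < A) (hb : -1 < b) (N : ℝ) (hw : -1 < w) :
    (1 + w) * hyperElasticity b A N w = (A + 1) * w + (N - 2 - A - b) * hyperPhi b A N w := by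
  refine mul_right_cancel₀ (hyperInt_pos hA hb N hw).ne' ?_
  have hA' : -1 < A + 1 := by linarith
  have hparts := hyperInt_parts hA hb N hw
  rw [hyperInt_add_one_left hA hb N hw, hyperInt_add_one_left hA' hb (N + 1) hw] at hparts
  linear_combination (1 + w) * hyperElasticity_mul_hyperInt hA hb N hw -
    (N - 2 - A - b) * hyperPhi_mul_hyperInt hA hb N hw - w * hparts -
    N * w * hyperInt_eq_add hA' hb N hw

theorem hyperElasticity_mul_one_add (hA : -1 < A) (hb : -1 < b) (N : ℝ) (hw : -1 < w) :
    hyperElasticity b A N w * (1 + hyperPhi b A (N + 1) w) = N * hyperPhi b A (N + 1) w := by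
  refine mul_right_cancel₀ (hyperInt_pos hA hb (N + 1) hw).ne' ?_
  linear_combination hyperElasticity_mul_hyperInt hA hb N hw -
    hyperElasticity b A N w * hyperInt_eq_add hA hb N hw +
    (hyperElasticity b A N w - N) * hyperPhi_mul_hyperInt hA hb (N + 1) hw

theorem hyperPhi_mul_one_add (hA : -1 < A) (hb : -1 < b) (N : ℝ) (hw : -1 < w) :
    hyperPhi b A N w * (1 + hyperPhi b A (N + 1) w) =
      hyperPhi b A (N + 1) w * (1 + hyperPhi b (A + 1) (N + 1) w) := by
  refine mul_right_cancel₀ (hyperInt_pos hA hb (N + 1) hw).ne' ?_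
  have hA' : -1 < A + 1 := by linarith
  linear_combination hyperPhi_mul_hyperInt hA hb N hw -
    hyperPhi b A N w * hyperInt_eq_add hA hb N hw + w * hyperInt_eq_add hA' hb N hw +
    (hyperPhi b A N w - 1 - hyperPhi b (A + 1) (N + 1) w) *
      hyperPhi_mul_hyperInt hA hb (N + 1) hw - w * hyperPhi_mul_hyperInt hA' hb (N + 1) hw

theorem hyperPhi_recurrence (hA : -1 < A) (hb : -1 < b) (N : ℝ) (hw : -1 < w) :
    (N - 3 - A - b) * (hyperPhi b A N w * hyperPhi b (A + 1) N w) =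
      ((N - 2 - A) * w + A + b + 2) * hyperPhi b A N w - (A + 1) * w := by
  have helast := hyperElasticity_mul_one_add hA hb (N - 1) hw
  have hmul := hyperPhi_mul_one_add hA hb (N - 1) hw
  rw [sub_add_cancel] at helast hmul
  linear_combination (1 + w) * helast - (N - 3 - A - b) * hmul -
    (1 + hyperPhi b A N w) * one_add_mul_hyperElasticity hA hb (N - 1) hw

theorem abs_hyperElasticity_le (hA : -1 < A) (hb : -1 < b) (N : ℝ) (hw : 0 ≤ w) :
    |hyperElasticity b A N w| ≤ |N| := by
  have hw' : -1 < w := by linarith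
  have hH := hyperInt_pos hA hb N hw'
  have hfirst := hyperInt_pos hA hb (N + 1) hw'
  have hsecond := mul_nonneg hw (hyperInt_pos (A := A + 1) (by linarith) hb (N + 1) hw').le
  rw [hyperElasticity, abs_div, abs_mul, abs_of_pos hH, div_le_iff₀ hH, abs_of_nonneg hsecond]
  refine mul_le_mul_of_nonneg_left ?_ (abs_nonneg N)
  linarith [hyperInt_eq_add hA hb N hw']

theorem hasDerivAt_hyperMean (hA : -1 < A) (hb : -1 < b) (N : ℝ) (hw : 0 < w) :
    HasDerivAt (hyperMean b A N)
      (hyperMean b A N w * (hyperElasticity b A N w - hyperElasticity b (A + 1) N w) / w) w := by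
  have hw' : -1 < w := by linarith
  have hA' : -1 < A + 1 := by linarith
  have hH := (hyperInt_pos hA hb N hw').ne'
  have hH' := (hyperInt_pos hA' hb N hw').ne'
  refine ((hasDerivAt_hyperInt hA' hb N hw').div
    (hasDerivAt_hyperInt hA hb N hw') hH).congr_deriv ?_
  simp only [hyperMean, hyperElasticity]
  field_simp
  ring

theorem abs_mul_deriv_hyperMean_le (hA : -1 < A) (hb : -1 < b) (N : ℝ) (hw : 0 < w) :
    |w * deriv (hyperMean b A N) w| ≤ 2 * |N| := by
  have hm := hyperMean_pos hA hb N (show -1 < w by linarith)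
  have hm_lt := hyperMean_lt_one hA hb N (show -1 < w by linarith)
  have hG := abs_hyperElasticity_le hA hb N hw.le
  have hG' := abs_hyperElasticity_le (A := A + 1) (by linarith) hb N hw.le
  rw [(hasDerivAt_hyperMean hA hb N hw).deriv, mul_div_cancel₀ _ hw.ne', abs_mul, abs_of_pos hm]
  calc _ ≤ 1 * |hyperElasticity b A N w - hyperElasticity b (A + 1) N w| := by gcongr
    _ ≤ 2 * |N| := by linarith [abs_sub (hyperElasticity b A N w) (hyperElasticity b (A + 1) N w)]

theorem hasDerivAt_hyperPhi (hA : -1 < A) (hb : -1 < b) (N : ℝ) (hw : 0 < w) :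
    HasDerivAt (hyperPhi b A N) (hyperPhi b A N w / w *
      (1 + hyperElasticity b A N w - hyperElasticity b (A + 1) N w)) w := by
  refine ((hasDerivAt_id w).mul (hasDerivAt_hyperMean hA hb N hw)).congr_deriv ?_
  simp only [hyperPhi, id_eq]
  field_simp
  ring

theorem mul_deriv_hyperPhi (hA : -1 < A) (hb : -1 < b) (N : ℝ) (hw : 0 < w) :
    w * deriv (hyperPhi b A N) w =
      hyperPhi b A N w * (1 + hyperElasticity b A N w - hyperElasticity b (A + 1) N w) := by
  rw [(hasDerivAt_hyperPhi hA hb N hw).deriv]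
  field_simp

theorem one_add_mul_mul_deriv_hyperPhi (hA : -1 < A) (hb : -1 < b) (N : ℝ) (hw : 0 < w) :
    (1 + w) * (w * deriv (hyperPhi b A N) w) =
      hyperPhi b A N w * (1 + (N - 2 - A - b) * hyperPhi b A N w -
        (N - 3 - A - b) * hyperPhi b (A + 1) N w) := by
  have hw' : -1 < w := by linarith
  rw [mul_deriv_hyperPhi hA hb N hw]
  linear_combination hyperPhi b A N w * (one_add_mul_hyperElasticity hA hb N hw' -
    one_add_mul_hyperElasticity (A := A + 1) (by linarith) hb N hw')

theorem riccati_hyperPhi (hA : -1 < A) (hb : -1 < b) (N : ℝ) (hw : 0 < w) :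
    (1 + w) * (w * deriv (hyperPhi b A N) w) =
      (A + 1 - (N - 2 - A) * hyperPhi b A N w) * (w - hyperPhi b A N w) -
        b * hyperPhi b A N w * (1 + hyperPhi b A N w) := by
  rw [one_add_mul_mul_deriv_hyperPhi hA hb N hw]
  linear_combination -hyperPhi_recurrence hA hb N (show -1 < w by linarith)

theorem one_sub_mul_le_rpow_neg {x : ℝ} (hx : 0 < x) (hN : 0 ≤ N) :
    1 - N * (x - 1) ≤ x ^ (-N) := by
  calc 1 - N * (x - 1) ≤ 1 - N * Real.log x := by gcongr; exact Real.log_le_sub_one_of_pos hx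
    _ = Real.log x * -N + 1 := by ring
    _ ≤ x ^ (-N) := (Real.add_one_le_exp _).trans_eq (Real.rpow_def_of_pos hx _).symm

theorem rpow_neg_sub_rpow_neg_le {x y : ℝ} (hx : 0 < x) (hy : 0 < y) (hN : 0 ≤ N) :
    x ^ (-N) - y ^ (-N) ≤ N * x ^ (-(N + 1)) * (y - x) := by
  have hbernoulli := one_sub_mul_le_rpow_neg (div_pos hy hx) hN
  have hsucc : x ^ (-N) = x ^ (-(N + 1)) * x := by
    rw [← Real.rpow_add_one hx.ne']
    ring_nf
  have hdiv : x * (y / x - 1) = y - x := by field_simp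
  rw [Real.div_rpow hy.le hx.le, le_div_iff₀ (Real.rpow_pos_of_pos hx _)] at hbernoulli
  calc x ^ (-N) - y ^ (-N) ≤ N * (y / x - 1) * x ^ (-N) := by linarith
    _ = N * x ^ (-(N + 1)) * (x * (y / x - 1)) := by rw [hsucc]; ring
    _ = _ := by rw [hdiv]

theorem hyperWeight_sub_le (hN : 0 ≤ N) (hw : 0 ≤ w) {t : ℝ} (ht : t ∈ Ioo (0 : ℝ) 1) :
    hyperWeight (b - 1) A N w t - (1 + w) ^ (-N) * hyperWeight (b - 1) A 0 w t ≤
      N * w * hyperWeight b A (N + 1) w t := by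
  have ht' : 0 < 1 - t := sub_pos.2 ht.2
  have hbase := one_add_mul_pos (show -1 < w by linarith) (Ioo_subset_Icc_self ht)
  have hweight : 0 ≤ t ^ A * (1 - t) ^ (b - 1) :=
    mul_nonneg (Real.rpow_nonneg ht.1.le _) (Real.rpow_nonneg ht'.le _)
  have htangent := mul_le_mul_of_nonneg_left
    (rpow_neg_sub_rpow_neg_le hbase (show 0 < 1 + w by linarith) hN) hweight
  have hpow : (1 - t) ^ b = (1 - t) ^ (b - 1) * (1 - t) := by
    rw [← Real.rpow_add_one ht'.ne', sub_add_cancel]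
  simp only [hyperWeight, hpow, neg_zero, Real.rpow_zero]
  linear_combination htangent

/-- For `N > 0` the factor that vanishes at `1` compensates the pole of `(1 - t) ^ b`. -/
theorem continuousOn_hyperWeight_sub (hA : -1 < A) (hb : -1 < b) (N : ℝ) (hw : -1 < w) :
    ContinuousOn (fun t => hyperWeight b (A + 1) N w t -
      (1 + w) ^ (-N) * hyperWeight b (A + 1) 0 w t) (Icc 0 1) := by
  set r : ℝ → ℝ := fun t => (1 + w * t) ^ (-N)
  have hr : ContinuousOn r (Icc 0 1) :=
    ContinuousOn.rpow_const (by fun_prop) fun _ ht => Or.inl (one_add_mul_pos hw ht).ne'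
  have hr_one : DifferentiableAt ℝ r 1 := by
    refine DifferentiableAt.rpow_const (by fun_prop) (Or.inl ?_)
    linarith
  have hslope : ContinuousOn (dslope r 1) (Icc 0 1) := fun t ht => by
    rcases eq_or_ne t 1 with rfl | hne
    · exact (continuousAt_dslope_same.2 hr_one).continuousWithinAt
    · exact (continuousWithinAt_dslope_of_ne hne).2 (hr t ht)
  refine ((continuousOn_hyperWeight_Icc (A := A + 1) (b := b + 1) 0 (by linarith) (by linarith)
    hw).mul hslope).neg.congr fun t ht => ?_
  rcases ht.2.lt_or_eq with hlt | rfl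
  · have hne : t - 1 ≠ 0 := by linarith
    simp only [Pi.mul_apply, Pi.neg_apply, hyperWeight_add_one_left b (A + 1) 0 w hlt]
    simp only [dslope_of_ne r hlt.ne, slope_def_field, hyperWeight, neg_zero, Real.rpow_zero, r,
      mul_one]
    field_simp
    ring
  · simp only [Pi.mul_apply, Pi.neg_apply, hyperWeight, sub_self, mul_one, neg_zero, Real.rpow_zero,
      Real.zero_rpow (show b + 1 ≠ 0 by linarith)]
    ring

/-- Integrate the derivative of `t ^ (A + 1) (1 - t) ^ b (r t - r 1)`, where
`r t = (1 + w t) ^ (-N)` is convex. -/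
theorem one_add_mul_hyperElasticity_le (hA : -1 < A) (hb : -1 < b) (hb' : b ≤ 0) (hN : 0 ≤ N)
    (hw : 0 ≤ w) : (1 + b) * hyperElasticity b A N w ≤ A + 1 := by
  have hw' : -1 < w := by linarith
  have i₁ := (integrableOn_hyperWeight hA hb N hw').const_mul (A + 1)
  have i₂ := (integrableOn_hyperWeight (A := A + 1) (by linarith) hb (N + 1) hw').const_mul
    ((1 + b) * (N * w))
  have hle := intervalIntegral.sub_le_integral_of_hasDeriv_right_of_le zero_le_one
    (continuousOn_hyperWeight_sub hA hb N hw')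
    (fun t ht => ((hasDerivAt_hyperWeight b (A + 1) N hw' ht).fun_sub
      ((hasDerivAt_hyperWeight b (A + 1) 0 hw' ht).const_mul _)).hasDerivWithinAt)
    ((integrableOn_Icc_iff_integrableOn_Ioo).2 (i₁.sub i₂)) fun t ht => by
      have hsub := mul_le_mul_of_nonneg_left (hyperWeight_sub_le (b := b) (A := A + 1) hN hw ht)
        (neg_nonneg.2 hb')
      have hnonneg : 0 ≤ (A + 1) * ((1 + w) ^ (-N) * hyperWeight b A 0 w t) :=
        mul_nonneg (by linarith) (mul_nonneg (Real.rpow_nonneg (by linarith) _)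
          (hyperWeight_pos b A 0 hw' ht).le)
      simp only [Pi.sub_apply, add_sub_cancel_right]
      linarith
  have hzero : ∀ M, hyperWeight b (A + 1) M w 0 = 0 := fun M => by
    simp [hyperWeight, Real.zero_rpow (show A + 1 ≠ 0 by linarith)]
  have hone : hyperWeight b (A + 1) N w 1 - (1 + w) ^ (-N) * hyperWeight b (A + 1) 0 w 1 = 0 := by
    simp only [hyperWeight, mul_one, neg_zero, Real.rpow_zero]
    ring
  rw [hone, hzero, hzero, mul_zero, sub_self, sub_self,
    intervalIntegral.integral_of_le zero_le_one, integral_Ioc_eq_integral_Ioo,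
    integral_sub' i₁ i₂, integral_const_mul, integral_const_mul] at hle
  refine le_of_mul_le_mul_right ?_ (hyperInt_pos hA hb N hw')
  rw [mul_assoc, hyperElasticity_mul_hyperInt hA hb N hw']
  unfold hyperInt
  linarith

theorem one_add_mul_hyperPhi_le (hA : -1 < A) (hb : -1 < b) (hb' : b ≤ 0) (hN : 1 ≤ N)
    (hw : 0 < w) : (1 + b) * (N - 1) * hyperPhi b A N w ≤ (A + 1) * (1 + hyperPhi b A N w) := by
  have helast := hyperElasticity_mul_one_add hA hb (N - 1) (show -1 < w by linarith)
  rw [sub_add_cancel] at helast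
  have hφ := hyperPhi_pos hA hb N hw
  have h := mul_le_mul_of_nonneg_right
    (one_add_mul_hyperElasticity_le hA hb hb' (sub_nonneg.2 hN) hw.le)
    (show 0 ≤ 1 + hyperPhi b A N w by linarith)
  rwa [mul_assoc, helast, ← mul_assoc] at h

/-- Since `φ` is at least its limit, the elasticity of order `A` is at least `A + 1`, while
convexity bounds the one of order `A + 1` by `(A + 2) / (1 + b)`. -/
theorem mul_hyperPhi_le_mul_deriv (hA : -1 < A) (hb : -1 < b) (hb' : b ≤ 0) (hN : 0 ≤ N)
    (hw : 0 < w) (hφ : A + 1 ≤ (N - 2 - A) * hyperPhi b A N w) :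
    b * (A + 2) * hyperPhi b A N w ≤ (1 + b) * (w * deriv (hyperPhi b A N) w) := by
  have hpos := hyperPhi_pos hA hb N hw
  have hupper := one_add_mul_hyperElasticity_le (A := A + 1) (by linarith) hb hb' hN hw.le
  have hlower : A + 1 ≤ hyperElasticity b A N w := by
    refine le_of_mul_le_mul_left ?_ (show 0 < 1 + w by linarith)
    rw [one_add_mul_hyperElasticity hA hb N (by linarith)]
    linarith [mul_nonneg (neg_nonneg.2 hb') hpos.le]
  have h : b * (A + 2) ≤
      (1 + b) * (1 + hyperElasticity b A N w - hyperElasticity b (A + 1) N w) := by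
    linarith [mul_le_mul_of_nonneg_left hlower (show 0 ≤ 1 + b by linarith)]
  rw [mul_deriv_hyperPhi hA hb N hw]
  linarith [mul_le_mul_of_nonneg_right h hpos.le]

theorem hyperPhi_le (hA : -1 < A) (hb : -1 < b) (hD : 0 < N - 2 - A) (hw : 0 < w) :
    hyperPhi b A N w ≤ (A + 1) / min (1 + b) (N - 2 - A) := by
  have hmin : 0 < min (1 + b) (N - 2 - A) := lt_min (by linarith) hD
  have hrec := hyperPhi_recurrence hA hb N (show -1 < w by linarith)
  have hpos := hyperPhi_pos hA hb N hw
  have hpos' := hyperPhi_pos (A := A + 1) (by linarith) hb N hw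
  have hlt' := hyperPhi_lt_self (A := A + 1) (by linarith) hb N hw
  rw [le_div_iff₀ hmin]
  refine le_of_mul_le_mul_left ?_ hw
  have hrest : 0 ≤ (A + b + 2) * hyperPhi b A N w := mul_nonneg (by linarith) hpos.le
  rcases le_total 0 (N - 3 - A - b) with hκ | hκ
  · rw [min_eq_left (by linarith)]
    linarith [mul_nonneg hκ (mul_nonneg hpos.le (sub_nonneg.2 hlt'.le))]
  · rw [min_eq_right (by linarith)]
    linarith [mul_nonneg (neg_nonneg.2 hκ) (mul_pos hpos hpos').le]

theorem tendsto_hyperMean_atTop (hA : -1 < A) (hb : -1 < b) (hD : 0 < N - 2 - A) :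
    Tendsto (hyperMean b A N) atTop (𝓝 0) := by
  refine squeeze_zero' (g := fun w => (A + 1) / min (1 + b) (N - 2 - A) / w) ?_ ?_
    (tendsto_const_nhds.div_atTop tendsto_id) <;> filter_upwards [eventually_gt_atTop 0] with w hw
  · exact (hyperMean_pos hA hb N (by linarith)).le
  · rw [le_div_iff₀ hw, mul_comm]
    exact hyperPhi_le hA hb hD hw

theorem rpow_le_rpow_mul_one_add {ε m t : ℝ} (hε : 0 ≤ ε) (hε' : ε ≤ 1) (hm : 0 < m) (ht : 0 ≤ t) :
    t ^ ε ≤ m ^ ε * (1 + ε * (t / m - 1)) := by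
  have h := rpow_one_add_le_one_add_mul_self
    (show -1 ≤ t / m - 1 by linarith [div_nonneg ht hm.le]) hε hε'
  rwa [add_sub_cancel, Real.div_rpow ht hm.le, div_le_iff₀' (Real.rpow_pos_of_pos hm _)] at h

/-- Jensen's inequality for the concave function `t ↦ t ^ ε`. -/
theorem hyperInt_add_le {ε : ℝ} (hA : -1 < A) (hb : -1 < b) (N : ℝ) (hw : -1 < w) (hε : 0 ≤ ε)
    (hε' : ε ≤ 1) : hyperInt b (A + ε) N w ≤ hyperMean b A N w ^ ε * hyperInt b A N w := by
  have hm := hyperMean_pos hA hb N hw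
  set m := hyperMean b A N w with hm_def
  have i₀ := (integrableOn_hyperWeight hA hb N hw).const_mul (m ^ ε * (1 - ε))
  have i₁ := (integrableOn_hyperWeight (A := A + 1) (by linarith) hb N hw).const_mul
    (m ^ ε * (ε / m))
  have hbound : hyperInt b (A + ε) N w ≤
      m ^ ε * (1 - ε) * hyperInt b A N w + m ^ ε * (ε / m) * hyperInt b (A + 1) N w := by
    simp only [hyperInt]
    rw [← integral_const_mul, ← integral_const_mul, ← integral_add i₀ i₁]
    refine setIntegral_mono_on (integrableOn_hyperWeight (by linarith) hb N hw) (i₀.add i₁)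
      measurableSet_Ioo fun t ht => ?_
    have hrpow := mul_le_mul_of_nonneg_right (rpow_le_rpow_mul_one_add hε hε' hm ht.1.le)
      (hyperWeight_pos b A N hw ht).le
    have hadd : hyperWeight b (A + ε) N w t = t ^ ε * hyperWeight b A N w t := by
      rw [hyperWeight, hyperWeight, Real.rpow_add ht.1]
      ring
    rw [hadd, hyperWeight_add_one _ _ _ _ ht.1]
    refine hrpow.trans_eq ?_
    field_simp
    ring
  refine hbound.trans_eq ?_
  rw [← hyperMean_mul_hyperInt hA hb N hw, ← hm_def]
  field_simp
  ring

theorem tendsto_hyperPhi_mul_hyperMean (hA : -1 < A) (hb : -1 < b) (hD : 0 < N - 2 - A) :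
    Tendsto (fun w => hyperPhi b A N w * hyperMean b (A + 1) N w) atTop (𝓝 0) := by
  obtain ⟨ε, hε, hε_lt⟩ : ∃ ε, 0 < ε ∧ ε < min (N - 2 - A) 1 := exists_between (lt_min hD one_pos)
  obtain ⟨hεD, hε_one⟩ := lt_min_iff.1 hε_lt
  set C := (A + ε + 1) / min (1 + b) (N - 2 - (A + ε))
  have hlim : Tendsto (fun w => C * hyperMean b A N w ^ ε) atTop (𝓝 0) := by
    simpa only [Real.zero_rpow hε.ne', mul_zero] using
      ((tendsto_hyperMean_atTop hA hb hD).rpow_const (Or.inr hε.le)).const_mul C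
  refine squeeze_zero' ?_ ?_ hlim <;> filter_upwards [eventually_gt_atTop 0] with w hw
  · exact (mul_pos (hyperPhi_pos hA hb N hw)
      (hyperMean_pos (by linarith) hb N (by linarith))).le
  have hw' : -1 < w := by linarith
  have hA' : -1 < A + 1 := by linarith
  have hAε : -1 < A + ε := by linarith
  refine le_of_mul_le_mul_right ?_ (hyperInt_pos hA hb N hw')
  calc hyperPhi b A N w * hyperMean b (A + 1) N w * hyperInt b A N w
      = w * hyperInt b (A + 1 + 1) N w := by
        rw [mul_right_comm, hyperPhi_mul_hyperInt hA hb N hw', mul_assoc,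
          mul_comm (hyperInt _ _ _ _), hyperMean_mul_hyperInt hA' hb N hw']
    _ ≤ w * hyperInt b (A + ε + 1) N w := by
        gcongr
        exact (hyperInt_strictAnti (by linarith) (by linarith) hb N hw').le
    _ = hyperPhi b (A + ε) N w * hyperInt b (A + ε) N w :=
        (hyperPhi_mul_hyperInt hAε hb N hw').symm
    _ ≤ C * (hyperMean b A N w ^ ε * hyperInt b A N w) :=
        mul_le_mul (hyperPhi_le hAε hb (by linarith) hw)
          (hyperInt_add_le hA hb N hw' hε.le hε_one.le) (hyperInt_pos hAε hb N hw').le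
          ((hyperPhi_pos hAε hb N hw).le.trans (hyperPhi_le hAε hb (by linarith) hw))
    _ = C * hyperMean b A N w ^ ε * hyperInt b A N w := (mul_assoc _ _ _).symm

theorem tendsto_hyperPhi (hA : -1 < A) (hb : -1 < b) (hD : 0 < N - 2 - A) :
    Tendsto (hyperPhi b A N) atTop (𝓝 ((A + 1) / (N - 2 - A))) := by
  have hlim := ((((tendsto_hyperPhi_mul_hyperMean hA hb hD).const_mul (N - 3 - A - b)).sub
    ((tendsto_hyperMean_atTop hA hb hD).const_mul (A + b + 2))).add_const (A + 1)).div_const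
      (N - 2 - A)
  rw [mul_zero, mul_zero, sub_zero, zero_add] at hlim
  refine hlim.congr' ?_
  filter_upwards [eventually_gt_atTop 0] with w hw
  have hrec := hyperPhi_recurrence hA hb N (show -1 < w by linarith)
  rw [div_eq_iff hD.ne']
  refine mul_left_cancel₀ hw.ne' ?_
  simp only [hyperPhi] at hrec ⊢
  linear_combination hrec

theorem monotoneOn_of_mul_deriv_nonneg {f : ℝ → ℝ} (hf : ∀ w, 0 < w → DifferentiableAt ℝ f w)
    (hderiv : ∀ w, 0 < w → 0 ≤ w * deriv f w) : MonotoneOn f (Ioi 0) := by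
  refine monotoneOn_of_deriv_nonneg (convex_Ioi 0)
    (fun w hw => (hf w hw).continuousAt.continuousWithinAt) ?_ ?_ <;> rw [interior_Ioi]
  · exact fun w hw => (hf w hw).differentiableWithinAt
  · exact fun w hw => nonneg_of_mul_nonneg_right (hderiv w hw) hw

/-- Under `hyperWeight b A N w` the means of `t` and of the increasing function `t / (1 - t)` are
positively correlated. -/
theorem hyperMean_mul_hyperInt_sub_one_le (hA : -1 < A) (hb : 0 < b) (N : ℝ) (hw : -1 < w) :
    hyperMean b A N w * hyperInt (b - 1) (A + 1) N w ≤ hyperInt (b - 1) (A + 1 + 1) N w := by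
  have hb' : -1 < b - 1 := by linarith
  have hbb : -1 < b := by linarith
  have hm_lt := hyperMean_lt_one hA hbb N hw
  set m := hyperMean b A N w with hm
  have i₀ := (integrableOn_hyperWeight hA hbb N hw).const_mul (m / (1 - m) * m)
  have i₁ := (integrableOn_hyperWeight (A := A + 1) (by linarith) hbb N hw).const_mul (m / (1 - m))
  have j₁ := (integrableOn_hyperWeight (A := A + 1) (by linarith) hb' N hw).const_mul m
  have j₂ := integrableOn_hyperWeight (A := A + 1 + 1) (by linarith) hb' N hw
  have hcov : ∫ t in Ioo (0 : ℝ) 1, (m / (1 - m) * hyperWeight b (A + 1) N w t -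
      m / (1 - m) * m * hyperWeight b A N w t) ≤ ∫ t in Ioo (0 : ℝ) 1,
        (hyperWeight (b - 1) (A + 1 + 1) N w t - m * hyperWeight (b - 1) (A + 1) N w t) := by
    refine setIntegral_mono_on (i₁.sub i₀) (j₂.sub j₁) measurableSet_Ioo fun t ht => ?_
    have hk := hyperWeight_pos (b - 1) A N hw ht
    have hb_eq := hyperWeight_add_one_left (b - 1) A N w ht.2
    rw [sub_add_cancel] at hb_eq
    simp only [hyperWeight_add_one _ _ _ _ ht.1, hb_eq]
    rw [← sub_nonneg]
    have hsq : 0 ≤ (t - m) ^ 2 / (1 - m) * hyperWeight (b - 1) A N w t :=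
      mul_nonneg (div_nonneg (sq_nonneg _) (sub_pos.2 hm_lt).le) hk.le
    refine hsq.trans_eq ?_
    field_simp [(sub_pos.2 ht.2).ne', (sub_pos.2 hm_lt).ne']
    ring
  rw [integral_sub i₁ i₀, integral_sub j₂ j₁, integral_const_mul, integral_const_mul,
    integral_const_mul] at hcov
  change m / (1 - m) * hyperInt b (A + 1) N w - m / (1 - m) * m * hyperInt b A N w ≤
    hyperInt (b - 1) (A + 1 + 1) N w - m * hyperInt (b - 1) (A + 1) N w at hcov
  rw [← hyperMean_mul_hyperInt hA hbb N hw, ← hm] at hcov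
  linarith

theorem hyperElasticity_succ_le (hA : -1 < A) (hb : 0 < b) (N : ℝ) (hw : -1 < w) :
    hyperElasticity b (A + 1) N w ≤ 1 + hyperElasticity b A N w := by
  have hbb : -1 < b := by linarith
  have hA' : -1 < A + 1 := by linarith
  have hH := hyperInt_pos hA hbb N hw
  have hm := hyperMean_pos hA hbb N hw
  have hparts := hyperInt_parts hA (show -1 < b - 1 by linarith) N hw
  have hparts' := hyperInt_parts hA' (show -1 < b - 1 by linarith) N hw
  rw [sub_add_cancel] at hparts hparts'
  have helast := hyperElasticity_mul_hyperInt hA hbb N hw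
  have helast' := hyperElasticity_mul_hyperInt hA' hbb N hw
  have hcov := mul_le_mul_of_nonneg_left (hyperMean_mul_hyperInt_sub_one_le hA hb N hw) hb.le
  rw [← hyperMean_mul_hyperInt hA hbb N hw] at hparts' helast'
  refine le_of_mul_le_mul_right ?_ (mul_pos hm hH)
  linear_combination hcov + helast' - hparts' - hyperMean b A N w * (helast - hparts)

theorem monotoneOn_hyperPhi (hA : -1 < A) (hb : -1 < b) (hbN : min (N - 3 - A) 0 ≤ b)
    (hD : 0 < N - 2 - A) : MonotoneOn (hyperPhi b A N) (Ioi 0) := by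
  refine monotoneOn_of_mul_deriv_nonneg
    (fun w hw => (hasDerivAt_hyperPhi hA hb N hw).differentiableAt) fun w hw => ?_
  have hpos := hyperPhi_pos hA hb N hw
  have hpos' := hyperPhi_pos (A := A + 1) (by linarith) hb N hw
  have hw' : 0 < 1 + w := by linarith
  rcases lt_trichotomy b 0 with hneg | rfl | hpos_b
  · have hκ : N - 3 - A ≤ b := (min_le_iff.1 hbN).resolve_right hneg.not_ge
    refine nonneg_of_mul_nonneg_right (b := w * _) ?_ hw'
    rw [one_add_mul_mul_deriv_hyperPhi hA hb N hw]
    exact mul_nonneg hpos.le (by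
      linarith [mul_pos (show 0 < N - 2 - A - b by linarith) hpos,
        mul_nonneg (show 0 ≤ -(N - 3 - A - b) by linarith) hpos'.le])
  · refine nonneg_of_mul_nonneg_right (b := w * _) ?_ hw'
    have hconvex := one_add_mul_hyperPhi_le hA hb le_rfl (show 1 ≤ N by linarith) hw
    rw [riccati_hyperPhi hA hb N hw, zero_mul, zero_mul, sub_zero]
    exact mul_nonneg (by linarith) (sub_nonneg.2 (hyperPhi_lt_self hA hb N hw).le)
  · rw [mul_deriv_hyperPhi hA hb N hw]
    exact mul_nonneg hpos.le
      (by linarith [hyperElasticity_succ_le hA hpos_b N (show -1 < w by linarith)])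

theorem hyperPhi_le_of_monotoneOn (hA : -1 < A) (hb : -1 < b) (hD : 0 < N - 2 - A)
    (hmono : MonotoneOn (hyperPhi b A N) (Ioi 0)) (hw : 0 < w) :
    hyperPhi b A N w ≤ (A + 1) / (N - 2 - A) := by
  refine ge_of_tendsto (tendsto_hyperPhi hA hb hD) ?_
  filter_upwards [eventually_ge_atTop w] with x hx
  exact hmono hw (hw.trans_le hx) hx

theorem not_antitoneOn_hyperPhi (hA : -1 < A) (hb : -1 < b) (N : ℝ) :
    ¬ AntitoneOn (hyperPhi b A N) (Ioi 0) := fun hanti =>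
  have hpos := hyperPhi_pos hA hb N one_pos
  (hyperPhi_lt_self hA hb N hpos).not_ge
    (hanti (mem_Ioi.2 hpos) (mem_Ioi.2 one_pos) (hyperPhi_lt_self hA hb N one_pos).le)

theorem neg_mul_hyperPhi_le_mul_deriv (hA : -1 < A) (hb : -1 < b) (hw : 0 < w)
    (hφ : (N - 2 - A - b) * hyperPhi b A N w ≤ A + 1) :
    -b * hyperPhi b A N w ≤ w * deriv (hyperPhi b A N) w := by
  have hlt := hyperPhi_lt_self hA hb N hw
  refine le_of_mul_le_mul_left ?_ (show 0 < 1 + w by linarith)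
  rw [riccati_hyperPhi hA hb N hw]
  linarith [mul_nonneg (sub_nonneg.2 hφ) (sub_nonneg.2 hlt.le)]

theorem monotoneOn_rpow_mul_hyperPhi (hA : -1 < A) (hb : -1 < b)
    (hφ : ∀ w, 0 < w → (N - 2 - A - b) * hyperPhi b A N w ≤ A + 1) :
    MonotoneOn (fun w => w ^ b * hyperPhi b A N w) (Ioi 0) := by
  have hderiv (w : ℝ) (hw : 0 < w) := (Real.hasDerivAt_rpow_const (p := b) (Or.inl hw.ne')).mul
    (hasDerivAt_hyperPhi hA hb N hw).differentiableAt.hasDerivAt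
  refine monotoneOn_of_mul_deriv_nonneg (fun w hw => (hderiv w hw).differentiableAt) fun w hw => ?_
  have hw_ne := hw.ne'
  have hscaled : w * deriv (fun w => w ^ b * hyperPhi b A N w) w =
      w ^ b * (b * hyperPhi b A N w + w * deriv (hyperPhi b A N) w) := by
    refine (congrArg (w * ·) (hderiv w hw).deriv).trans ?_
    simp only [Real.rpow_sub_one hw.ne']
    field_simp
  rw [hscaled]
  exact mul_nonneg (Real.rpow_nonneg hw.le b)
    (by linarith [neg_mul_hyperPhi_le_mul_deriv hA hb hw (hφ w hw)])

/-- Otherwise `w ^ b * φ` increases, so that `φ` grows at least like `w ^ (-b)`. -/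
theorem exists_lt_mul_hyperPhi (hA : -1 < A) (hb : -1 < b) (hb' : b < 0) (hN : 0 < N - 2 - A - b) :
    ∃ w, 0 < w ∧ A + 1 < (N - 2 - A - b) * hyperPhi b A N w := by
  by_contra! hφ
  have hmono := monotoneOn_rpow_mul_hyperPhi hA hb hφ
  have hlim : Tendsto (fun w : ℝ => w ^ b * ((A + 1) / (N - 2 - A - b))) atTop (𝓝 0) := by
    simpa only [neg_neg, zero_mul] using (tendsto_rpow_neg_atTop (neg_pos.2 hb')).mul_const _
  refine (hyperPhi_pos hA hb N one_pos).not_ge (ge_of_tendsto hlim ?_)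
  filter_upwards [eventually_ge_atTop 1] with w hw
  have hw' : 0 < w := one_pos.trans_le hw
  calc hyperPhi b A N 1 = 1 ^ b * hyperPhi b A N 1 := by rw [Real.one_rpow, one_mul]
    _ ≤ w ^ b * hyperPhi b A N w := hmono (mem_Ioi.2 one_pos) (mem_Ioi.2 hw') hw
    _ ≤ w ^ b * ((A + 1) / (N - 2 - A - b)) := by
        gcongr
        exact (le_div_iff₀' hN).2 (hφ w hw')

theorem sub_mul_hyperPhi_sub_one_le (hA : -1 < A) (hb : -1 < b) (hw : 0 < w)
    (hφ : (N - 2 - A) * hyperPhi b A N w ≤ A + 1) :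
    (N - 3 - A - b) * hyperPhi b A (N - 1) w ≤ A + 1 := by
  have hw' : -1 < w := by linarith
  have hpos := hyperPhi_pos hA hb N hw
  have helast := hyperElasticity_mul_one_add hA hb (N - 1) hw'
  rw [sub_add_cancel] at helast
  have helast_le : hyperElasticity b A (N - 1) w ≤ A + 1 :=
    le_of_mul_le_mul_right (by linarith) (show 0 < 1 + hyperPhi b A N w by linarith)
  linarith [one_add_mul_hyperElasticity hA hb (N - 1) hw',
    mul_le_mul_of_nonneg_left helast_le (show 0 ≤ 1 + w by linarith)]

theorem exists_limit_lt_hyperPhi (hA : -1 < A) (hb : -1 < b) (hb' : b < 0)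
    (hbN : b < N - 3 - A) : ∃ w, 0 < w ∧ (A + 1) / (N - 2 - A) < hyperPhi b A N w := by
  obtain ⟨w, hw, hlt⟩ := exists_lt_mul_hyperPhi (N := N - 1) hA hb hb' (by linarith)
  refine ⟨w, hw, (div_lt_iff₀' (by linarith)).2 ?_⟩
  contrapose! hlt
  linarith [sub_mul_hyperPhi_sub_one_le hA hb hw hlt]

theorem not_monotoneOn_hyperPhi (hA : -1 < A) (hb : -1 < b) (hb' : b < 0) (hbN : b < N - 3 - A) :
    ¬ MonotoneOn (hyperPhi b A N) (Ioi 0) := fun hmono =>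
  have ⟨_, hw, hlt⟩ := exists_limit_lt_hyperPhi hA hb hb' hbN
  (hyperPhi_le_of_monotoneOn hA hb (by linarith) hmono hw).not_gt hlt

theorem mul_hyperPhi_le_of_monotoneOn {ν c : ℝ} (hA : -1 < A) (hb : -1 < b) (hD : 0 < N - 2 - A)
    (hmono : MonotoneOn (hyperPhi b A N) (Ioi 0)) (hν : 0 ≤ ν) (hc : (A + 1) / (N - 2 - A) ≤ c)
    (hw : 0 < w) :
    ν * (hyperPhi b A N w * (hyperPhi b A N w - c)) ≤
      4 * (w * deriv (hyperPhi b A N) w) * (1 + hyperPhi b A N w) := by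
  have hpos := hyperPhi_pos hA hb N hw
  have hle := (hyperPhi_le_of_monotoneOn hA hb hD hmono hw).trans hc
  have hderiv : 0 ≤ deriv (hyperPhi b A N) w := by
    rw [← derivWithin_of_isOpen isOpen_Ioi hw]
    exact hmono.derivWithin_nonneg
  have hrhs : 0 ≤ 4 * (w * deriv (hyperPhi b A N) w) * (1 + hyperPhi b A N w) := by positivity
  have hlhs : 0 ≤ ν * (hyperPhi b A N w * (c - hyperPhi b A N w)) :=
    mul_nonneg hν (mul_nonneg hpos.le (sub_nonneg.2 hle))
  linarith

/-- The inequality is affine in `x`, and is checked at the largest admissible `x`, which is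
`α / (1 + b * (1 + α))`. -/
theorem mul_sub_le_of_mul_le {α ν c x : ℝ} (hA : -1 < A) (hb : -1 < b) (hb' : b ≤ 0) (hα : 0 ≤ α)
    (hν : 0 ≤ ν) (hc : 0 ≤ c) (hcond : ν * (α - c) ≤ b * (1 + α) * (4 * (A + 2) + ν * c))
    (hx : (1 + b * (1 + α)) * x ≤ α) :
    (1 + b) * (ν * (x - c)) ≤ 4 * (b * (A + 2) * (1 + x)) := by
  have hP : 0 < 1 + b * (1 + α) := by
    have hK : 0 < 4 * (A + 2) + ν * c := by linarith [mul_nonneg hν hc]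
    refine pos_of_mul_pos_left (b := 4 * (A + 2) + ν * c) ?_ hK.le
    linarith [mul_nonneg hν hα]
  have hslope : 0 ≤ ν * (1 + b) - 4 * b * (A + 2) := by
    linarith [mul_nonneg hν (show 0 ≤ 1 + b by linarith),
      mul_nonneg (neg_nonneg.2 hb') (show 0 ≤ A + 2 by linarith)]
  refine le_of_mul_le_mul_left ?_ hP
  linear_combination mul_le_mul_of_nonneg_left hx hslope +
    mul_le_mul_of_nonneg_left hcond (show 0 ≤ 1 + b by linarith)

theorem mul_hyperPhi_le_of_le {ν c : ℝ} (hA : -1 < A) (hb : -1 < b) (hb' : b ≤ 0)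
    (hD : 0 < N - 2 - A) (hν : 0 < ν) (hc : 0 ≤ c)
    (hcond : ν * ((A + 1) / (N - 2 - A) - c) ≤
      b * (1 + (A + 1) / (N - 2 - A)) * (4 * (A + 2) + ν * c)) (hw : 0 < w) :
    ν * (hyperPhi b A N w * (hyperPhi b A N w - c)) ≤
      4 * (w * deriv (hyperPhi b A N) w) * (1 + hyperPhi b A N w) := by
  have hα : 0 < (A + 1) / (N - 2 - A) := div_pos (by linarith) hD
  have hDα := mul_div_cancel₀ (A + 1) hD.ne'
  set α := (A + 1) / (N - 2 - A)
  have hpos := hyperPhi_pos hA hb N hw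
  have hlt := hyperPhi_lt_self hA hb N hw
  rcases le_total ((N - 2 - A) * hyperPhi b A N w) (A + 1) with hle | hge
  · have hφα : hyperPhi b A N w ≤ α := (le_div_iff₀' hD).2 hle
    have hαc : α ≤ c := by
      refine sub_nonpos.1 (nonpos_of_mul_nonpos_right (hcond.trans ?_) hν)
      exact mul_nonpos_of_nonpos_of_nonneg (mul_nonpos_of_nonpos_of_nonneg hb' (by linarith))
        (by linarith [mul_nonneg hν.le hc])
    have hderiv : 0 ≤ w * deriv (hyperPhi b A N) w := by
      refine nonneg_of_mul_nonneg_right ?_ (show 0 < 1 + w by linarith)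
      rw [riccati_hyperPhi hA hb N hw]
      linarith [mul_nonneg (sub_nonneg.2 hle) (sub_nonneg.2 hlt.le),
        mul_nonneg (mul_nonneg (neg_nonneg.2 hb') hpos.le)
          (show 0 ≤ 1 + hyperPhi b A N w by linarith)]
    refine (mul_nonpos_of_nonneg_of_nonpos hν.le (mul_nonpos_of_nonneg_of_nonpos hpos.le
      (by linarith))).trans (by positivity)
  · have hconvex : (1 + b * (1 + α)) * hyperPhi b A N w ≤ α := by
      refine le_of_mul_le_mul_left ?_ hD
      linear_combination one_add_mul_hyperPhi_le hA hb hb' (show 1 ≤ N by linarith) hw +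
        (b * hyperPhi b A N w + hyperPhi b A N w - 1 - hyperPhi b A N w) * hDα
    have hderiv := mul_hyperPhi_le_mul_deriv hA hb hb' (show 0 ≤ N by linarith) hw hge
    have hstein := mul_sub_le_of_mul_le hA hb hb' hα.le hν.le hc hcond hconvex
    refine le_of_mul_le_mul_left ?_ (show 0 < 1 + b by linarith)
    linear_combination hyperPhi b A N w * hstein + 4 * (1 + hyperPhi b A N w) * hderiv

end HypergeometricIntegrals

section Gaussian

variable {d : ℕ} {v : ℝ}

theorem isoNormalPDF_pos (hv : 0 < v) (x : EuclideanSpace ℝ (Fin d)) : 0 < isoNormalPDF d v x := by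
  unfold isoNormalPDF
  positivity

theorem continuous_isoNormalPDF (v : ℝ) : Continuous (isoNormalPDF d v) := by
  unfold isoNormalPDF
  fun_prop

theorem isoNormalPDF_neg (v : ℝ) (x : EuclideanSpace ℝ (Fin d)) :
    isoNormalPDF d v (-x) = isoNormalPDF d v x := by
  rw [isoNormalPDF, isoNormalPDF, norm_neg]

theorem integral_isoNormalPDF (hv : 0 < v) : ∫ x, isoNormalPDF d v x = 1 := by
  have hgauss := GaussianFourier.integral_rexp_neg_mul_sq_norm (V := EuclideanSpace ℝ (Fin d))
    (b := (2 * v)⁻¹) (by positivity)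
  have hexp (x : EuclideanSpace ℝ (Fin d)) : -‖x‖ ^ 2 / (2 * v) = -(2 * v)⁻¹ * ‖x‖ ^ 2 := by ring
  simp only [isoNormalPDF, hexp]
  rw [integral_const_mul, hgauss, finrank_euclideanSpace_fin, div_inv_eq_mul, mul_left_comm,
    ← mul_assoc, ← Real.rpow_add (by positivity), neg_div, neg_add_cancel, Real.rpow_zero]

theorem integrable_isoNormalPDF (hv : 0 < v) : Integrable (isoNormalPDF d v) :=
  Integrable.of_integral_ne_zero ((integral_isoNormalPDF hv).trans_ne one_ne_zero)

/-- From `s * exp (-s) ≤ 1` at `s = ‖x‖ ^ 2 / (4 * v)`. -/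
theorem norm_sq_mul_isoNormalPDF_le (hv : 0 < v) (x : EuclideanSpace ℝ (Fin d)) :
    ‖x‖ ^ 2 * isoNormalPDF d v x ≤
      4 * v * 2 ^ ((d : ℝ) / 2) * isoNormalPDF d (2 * v) x := by
  set s := ‖x‖ ^ 2 / (4 * v) with hs
  have hs_le : s * Real.exp (-s) ≤ 1 := by
    rw [Real.exp_neg, ← div_eq_mul_inv, div_le_one (Real.exp_pos s)]
    linarith [Real.add_one_le_exp s]
  have hexp : Real.exp (-‖x‖ ^ 2 / (2 * v)) = Real.exp (-s) * Real.exp (-s) := by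
    rw [← Real.exp_add, hs]
    congr 1
    field_simp
    ring
  have hexp' : Real.exp (-‖x‖ ^ 2 / (2 * (2 * v))) = Real.exp (-s) := by
    rw [hs]
    congr 1
    field_simp
    ring
  have hnorm : (2 : ℝ) ^ ((d : ℝ) / 2) * (2 * Real.pi * (2 * v)) ^ (-(d : ℝ) / 2) =
      (2 * Real.pi * v) ^ (-(d : ℝ) / 2) := by
    rw [mul_left_comm, Real.mul_rpow (by positivity) (by positivity), ← mul_assoc,
      ← Real.rpow_add two_pos, neg_div, add_neg_cancel, Real.rpow_zero, one_mul]
  have hx : ‖x‖ ^ 2 = 4 * v * s := by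
    rw [hs]
    field_simp
  calc ‖x‖ ^ 2 * isoNormalPDF d v x
      = 4 * v * (2 * Real.pi * v) ^ (-(d : ℝ) / 2) * (s * Real.exp (-s)) * Real.exp (-s) := by
        rw [isoNormalPDF, hexp, hx]
        ring
    _ ≤ 4 * v * (2 * Real.pi * v) ^ (-(d : ℝ) / 2) * 1 * Real.exp (-s) := by gcongr
    _ = 4 * v * 2 ^ ((d : ℝ) / 2) * isoNormalPDF d (2 * v) x := by
        rw [isoNormalPDF, hexp', ← hnorm]
        ring

theorem integrable_norm_sq_mul_isoNormalPDF (hv : 0 < v) :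
    Integrable fun x : EuclideanSpace ℝ (Fin d) => ‖x‖ ^ 2 * isoNormalPDF d v x := by
  refine ((integrable_isoNormalPDF (d := d) (v := 2 * v) (by positivity)).const_mul
    (4 * v * 2 ^ ((d : ℝ) / 2))).mono'
    ((continuous_norm.pow 2).mul (continuous_isoNormalPDF v)).aestronglyMeasurable
    (Eventually.of_forall fun x => ?_)
  rw [Real.norm_of_nonneg (mul_nonneg (sq_nonneg _) (isoNormalPDF_pos hv x).le)]
  exact norm_sq_mul_isoNormalPDF_le hv x

theorem integrable_mul_isoNormalPDF (hv : 0 < v) (θ : EuclideanSpace ℝ (Fin d))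
    {f : EuclideanSpace ℝ (Fin d) → ℝ} (hf : AEStronglyMeasurable f) {C : ℝ}
    (hC : ∀ x, |f x| ≤ C * (1 + ‖x‖ ^ 2)) :
    Integrable fun x => f x * isoNormalPDF d v (x - θ) := by
  have hC₀ : 0 ≤ C := by simpa using (abs_nonneg _).trans (hC 0)
  have hmajorant : Integrable fun x : EuclideanSpace ℝ (Fin d) =>
      C * ((1 + 2 * ‖θ‖ ^ 2) * isoNormalPDF d v x + 2 * (‖x‖ ^ 2 * isoNormalPDF d v x)) :=
    (((integrable_isoNormalPDF hv).const_mul _).add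
      ((integrable_norm_sq_mul_isoNormalPDF hv).const_mul 2)).const_mul C
  refine (hmajorant.comp_sub_right θ).mono' (hf.mul
    ((continuous_isoNormalPDF v).comp (continuous_sub_right θ)).aestronglyMeasurable)
    (Eventually.of_forall fun x => ?_)
  have hpos := isoNormalPDF_pos hv (x - θ)
  have hnorm : ‖x‖ ^ 2 ≤ 2 * (‖x - θ‖ ^ 2 + ‖θ‖ ^ 2) := by
    have htri : ‖x‖ ≤ ‖x - θ‖ + ‖θ‖ := by simpa using norm_add_le (x - θ) θ
    exact (pow_le_pow_left₀ (norm_nonneg x) htri 2).trans add_sq_le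
  rw [norm_mul, Real.norm_eq_abs, Real.norm_of_nonneg hpos.le]
  calc |f x| * isoNormalPDF d v (x - θ)
      ≤ C * (1 + 2 * (‖x - θ‖ ^ 2 + ‖θ‖ ^ 2)) * isoNormalPDF d v (x - θ) := by
        gcongr
        exact (hC x).trans (by gcongr)
    _ = _ := by ring

theorem norm_add_smul_single_sq (x : EuclideanSpace ℝ (Fin d)) (i : Fin d) (t : ℝ) :
    ‖x + t • EuclideanSpace.single i (1 : ℝ)‖ ^ 2 = ‖x‖ ^ 2 + 2 * x i * t + t ^ 2 := by
  rw [norm_add_sq_real, norm_smul, inner_smul_right, EuclideanSpace.inner_single_right,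
    PiLp.norm_single]
  simp only [Real.ringHom_apply, one_mul, Real.norm_eq_abs, norm_one, mul_one, sq_abs,
    add_left_inj, add_right_inj]
  ring

theorem hasDerivAt_add_mul_add_sq (r x : ℝ) :
    HasDerivAt (fun t : ℝ => r + 2 * x * t + t ^ 2) (2 * x) 0 := by
  refine ((((hasDerivAt_id (0 : ℝ)).const_mul (2 * x)).const_add r).add
    ((hasDerivAt_id (0 : ℝ)).pow 2)).congr_deriv ?_
  simp

theorem hasLineDerivAt_isoNormalPDF (hv : 0 < v) (θ x : EuclideanSpace ℝ (Fin d)) (i : Fin d) :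
    HasLineDerivAt ℝ (fun y => isoNormalPDF d v (y - θ))
      (-(x i - θ i) / v * isoNormalPDF d v (x - θ)) x (EuclideanSpace.single i (1 : ℝ)) := by
  have hline (t : ℝ) : ‖x + t • EuclideanSpace.single i (1 : ℝ) - θ‖ ^ 2 =
      ‖x - θ‖ ^ 2 + 2 * (x i - θ i) * t + t ^ 2 := by
    rw [add_sub_right_comm, norm_add_smul_single_sq, PiLp.sub_apply]
  simp only [HasLineDerivAt, isoNormalPDF, hline]
  refine ((((hasDerivAt_add_mul_add_sq _ _).neg.div_const (2 * v)).exp).const_mul _).congr_deriv ?_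
  simp only [Pi.neg_apply, mul_zero, add_zero, ne_eq, OfNat.ofNat_ne_zero, not_false_eq_true,
    zero_pow]
  field_simp

/-- The radial profiles `G` to which Stein's identity is applied, through the vector field
`x ↦ G (‖x‖ ^ 2) • x`. The constant `C` bounds both the function and its derivative with respect to
`log r`, which makes both sides of the identity integrable. -/
structure IsSteinFunction (C : ℝ) (G : ℝ → ℝ) : Prop where
  continuousWithinAt_zero : ContinuousWithinAt G (Ici 0) 0
  differentiableAt : ∀ r, 0 < r → DifferentiableAt ℝ G r
  abs_le : ∀ r, 0 ≤ r → |G r| ≤ C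
  abs_mul_deriv_le : ∀ r, 0 ≤ r → |r * deriv G r| ≤ C

namespace IsSteinFunction

variable {C : ℝ} {G : ℝ → ℝ}

theorem nonneg (hG : IsSteinFunction C G) : 0 ≤ C := (abs_nonneg _).trans (hG.abs_le 0 le_rfl)

theorem continuousOn (hG : IsSteinFunction C G) : ContinuousOn G (Ici 0) := fun r hr => by
  rcases (mem_Ici.1 hr).eq_or_lt with rfl | hr
  · exact hG.continuousWithinAt_zero
  · exact (hG.differentiableAt r hr).continuousAt.continuousWithinAt

theorem continuous_norm_sq (hG : IsSteinFunction C G) :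
    Continuous fun x : EuclideanSpace ℝ (Fin d) => G (‖x‖ ^ 2) :=
  hG.continuousOn.comp_continuous (by fun_prop) fun x => sq_nonneg ‖x‖

theorem hasLineDerivAt_coord_mul (hG : IsSteinFunction C G) (x : EuclideanSpace ℝ (Fin d))
    (i : Fin d) :
    HasLineDerivAt ℝ (fun y : EuclideanSpace ℝ (Fin d) => y i * G (‖y‖ ^ 2))
      (G (‖x‖ ^ 2) + 2 * x i ^ 2 * deriv G (‖x‖ ^ 2)) x (EuclideanSpace.single i (1 : ℝ)) := by
  have hcoord (t : ℝ) : (x + t • EuclideanSpace.single i (1 : ℝ)) i = x i + t := by simp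
  simp only [HasLineDerivAt, norm_add_smul_single_sq, hcoord]
  rcases eq_or_ne x 0 with rfl | hx
  · simp only [norm_zero, PiLp.zero_apply, zero_add, mul_zero, zero_mul, ne_eq,
      OfNat.ofNat_ne_zero, not_false_eq_true, zero_pow, add_zero]
    have hlim : Tendsto (fun t : ℝ => G (t ^ 2)) (𝓝[≠] 0) (𝓝 (G 0)) := by
      have hcont : ContinuousAt (fun t : ℝ => G (t ^ 2)) 0 :=
        (hG.continuousOn.comp_continuous (continuous_pow 2) fun t => sq_nonneg t).continuousAt
      simpa only [ContinuousAt, ne_eq, OfNat.ofNat_ne_zero, not_false_eq_true, zero_pow] using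
        hcont.mono_left nhdsWithin_le_nhds
    refine hasDerivAt_iff_tendsto_slope.2 (hlim.congr' ?_)
    filter_upwards [self_mem_nhdsWithin] with t ht
    simp [slope_def_field, mul_div_cancel_left₀ _ (show t ≠ 0 from ht)]
  · have hradius : ‖x‖ ^ 2 + 2 * x i * 0 + 0 ^ 2 = ‖x‖ ^ 2 := by ring
    have hprofile : HasDerivAt G (deriv G (‖x‖ ^ 2)) (‖x‖ ^ 2 + 2 * x i * 0 + 0 ^ 2) := by
      rw [hradius]
      exact (hG.differentiableAt _ (by positivity)).hasDerivAt
    refine (((hasDerivAt_id (0 : ℝ)).const_add (x i)).fun_mul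
      (hprofile.comp (0 : ℝ) (hasDerivAt_add_mul_add_sq _ _))).congr_deriv ?_
    simp only [Function.comp_apply, hradius, id_eq, add_zero]
    ring

theorem abs_coord_sq_mul_deriv_le (hG : IsSteinFunction C G) (x : EuclideanSpace ℝ (Fin d))
    (i : Fin d) : |x i ^ 2 * deriv G (‖x‖ ^ 2)| ≤ C := by
  refine le_trans ?_ (hG.abs_mul_deriv_le (‖x‖ ^ 2) (sq_nonneg _))
  rw [abs_mul, abs_mul, abs_of_nonneg (sq_nonneg (x i)), abs_of_nonneg (sq_nonneg ‖x‖)]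
  gcongr ?_ * _
  rw [← sq_abs, ← Real.norm_eq_abs]
  gcongr
  exact PiLp.norm_apply_le x i

theorem integrable_mul_coord (hG : IsSteinFunction C G) (hv : 0 < v)
    (θ : EuclideanSpace ℝ (Fin d)) (i : Fin d) :
    Integrable fun x : EuclideanSpace ℝ (Fin d) =>
      x i * G (‖x‖ ^ 2) * isoNormalPDF d v (x - θ) := by
  refine integrable_mul_isoNormalPDF hv θ (C := C)
    ((EuclideanSpace.proj i).continuous.mul hG.continuous_norm_sq).aestronglyMeasurable fun x => ?_
  rw [abs_mul, mul_comm]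
  refine mul_le_mul (hG.abs_le _ (sq_nonneg _)) ?_ (abs_nonneg _) hG.nonneg
  exact (PiLp.norm_apply_le x i).trans (by linarith [sq_nonneg (‖x‖ - 1 / 2)])

theorem integrable_mul_coord_mul_sub (hG : IsSteinFunction C G) (hv : 0 < v)
    (θ : EuclideanSpace ℝ (Fin d)) (i : Fin d) :
    Integrable fun x : EuclideanSpace ℝ (Fin d) =>
      x i * (x i - θ i) * G (‖x‖ ^ 2) * isoNormalPDF d v (x - θ) := by
  have hproj : Continuous fun x : EuclideanSpace ℝ (Fin d) => x i := by fun_prop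
  refine integrable_mul_isoNormalPDF hv θ (C := C * (2 + |θ i| ^ 2))
    (((hproj.mul (hproj.sub continuous_const)).mul hG.continuous_norm_sq).aestronglyMeasurable)
    fun x => ?_
  rw [abs_mul, mul_comm, mul_assoc]
  refine mul_le_mul (hG.abs_le _ (sq_nonneg _)) ?_ (abs_nonneg _) hG.nonneg
  have hcoord := pow_le_pow_left₀ (abs_nonneg _) (PiLp.norm_apply_le x i) 2
  rw [Real.norm_eq_abs, sq_abs] at hcoord
  rw [sq_abs, _root_.abs_le]
  constructor <;>
    linarith [sq_nonneg (θ i), sq_nonneg (x i + (x i - θ i)), sq_nonneg (x i + θ i),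
      mul_nonneg (sq_nonneg (θ i)) (sq_nonneg ‖x‖), sq_nonneg (x i)]

theorem integrable_lineDeriv (hG : IsSteinFunction C G) (hv : 0 < v)
    (θ : EuclideanSpace ℝ (Fin d)) (i : Fin d) :
    Integrable fun x : EuclideanSpace ℝ (Fin d) =>
      (G (‖x‖ ^ 2) + 2 * x i ^ 2 * deriv G (‖x‖ ^ 2)) * isoNormalPDF d v (x - θ) := by
  have hderiv : Measurable fun x : EuclideanSpace ℝ (Fin d) => deriv G (‖x‖ ^ 2) :=
    (measurable_deriv G).comp (by fun_prop)
  have hproj : Measurable fun x : EuclideanSpace ℝ (Fin d) => x i := by fun_prop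
  refine integrable_mul_isoNormalPDF hv θ (C := 3 * C) (hG.continuous_norm_sq.measurable.add
    (((hproj.pow_const 2).const_mul 2).mul hderiv)).aestronglyMeasurable fun x => ?_
  have hsum := abs_add_le (G (‖x‖ ^ 2)) (2 * (x i ^ 2 * deriv G (‖x‖ ^ 2)))
  rw [abs_mul 2, abs_two, ← mul_assoc] at hsum
  linarith [hG.abs_le _ (sq_nonneg ‖x‖), hG.abs_coord_sq_mul_deriv_le x i,
    mul_nonneg hG.nonneg (sq_nonneg ‖x‖)]

theorem integral_coord (hG : IsSteinFunction C G) (hv : 0 < v) (θ : EuclideanSpace ℝ (Fin d))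
    (i : Fin d) :
    ∫ x : EuclideanSpace ℝ (Fin d), x i * (x i - θ i) * G (‖x‖ ^ 2) * isoNormalPDF d v (x - θ) =
      v * ∫ x : EuclideanSpace ℝ (Fin d),
        (G (‖x‖ ^ 2) + 2 * x i ^ 2 * deriv G (‖x‖ ^ 2)) * isoNormalPDF d v (x - θ) := by
  have hscale (x : EuclideanSpace ℝ (Fin d)) :
      x i * G (‖x‖ ^ 2) * (-(x i - θ i) / v * isoNormalPDF d v (x - θ)) =
        -v⁻¹ * (x i * (x i - θ i) * G (‖x‖ ^ 2) * isoNormalPDF d v (x - θ)) := by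
    field_simp
  have hparts := integral_bilinear_hasLineDerivAt_right_eq_neg_left_of_integrable
    (B := ContinuousLinearMap.mul ℝ ℝ) (hG.integrable_lineDeriv hv θ i)
    (((hG.integrable_mul_coord_mul_sub hv θ i).const_mul (-v⁻¹)).congr
      (Eventually.of_forall fun x => (hscale x).symm)) (hG.integrable_mul_coord hv θ i)
    (fun x _ => hG.hasLineDerivAt_coord_mul x i) (fun x _ => hasLineDerivAt_isoNormalPDF hv θ x i)
  simp only [ContinuousLinearMap.mul_apply', hscale] at hparts
  rwa [integral_const_mul, neg_mul, neg_inj, inv_mul_eq_iff_eq_mul₀ hv.ne'] at hparts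

/-- Stein's identity for the vector field `x ↦ G (‖x‖ ^ 2) • x`. -/
theorem integral_inner (hG : IsSteinFunction C G) (hv : 0 < v) (θ : EuclideanSpace ℝ (Fin d)) :
    ∫ x, inner ℝ x (x - θ) * G (‖x‖ ^ 2) * isoNormalPDF d v (x - θ) =
      v * ∫ x, (d * G (‖x‖ ^ 2) + 2 * (‖x‖ ^ 2 * deriv G (‖x‖ ^ 2))) *
        isoNormalPDF d v (x - θ) := by
  have hinner (x : EuclideanSpace ℝ (Fin d)) :
      ∑ i, x i * (x i - θ i) * G (‖x‖ ^ 2) * isoNormalPDF d v (x - θ) =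
        inner ℝ x (x - θ) * G (‖x‖ ^ 2) * isoNormalPDF d v (x - θ) := by
    rw [PiLp.inner_apply, ← Finset.sum_mul, ← Finset.sum_mul]
    simp only [PiLp.sub_apply, Real.inner_apply, mul_comm]
  have hdiv (x : EuclideanSpace ℝ (Fin d)) :
      ∑ i, (G (‖x‖ ^ 2) + 2 * x i ^ 2 * deriv G (‖x‖ ^ 2)) * isoNormalPDF d v (x - θ) =
        (d * G (‖x‖ ^ 2) + 2 * (‖x‖ ^ 2 * deriv G (‖x‖ ^ 2))) * isoNormalPDF d v (x - θ) := by
    rw [← Finset.sum_mul, Finset.sum_add_distrib, ← Finset.sum_mul, ← Finset.mul_sum,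
      ← EuclideanSpace.real_norm_sq_eq, Finset.sum_const, Finset.card_univ, Fintype.card_fin,
      nsmul_eq_mul, mul_assoc 2]
  have hsum := Finset.sum_congr rfl fun i (_ : i ∈ Finset.univ) => hG.integral_coord hv θ i
  rw [← Finset.mul_sum,
    ← integral_finsetSum _ fun i _ => hG.integrable_mul_coord_mul_sub hv θ i,
    ← integral_finsetSum _ fun i _ => hG.integrable_lineDeriv hv θ i] at hsum
  simpa only [hinner, hdiv] using hsum

end IsSteinFunction

theorem isSteinFunction_one : IsSteinFunction 1 fun _ => 1 where
  continuousWithinAt_zero := continuousWithinAt_const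
  differentiableAt _ _ := differentiableAt_const _
  abs_le _ _ := by simp
  abs_mul_deriv_le _ _ := by simp

theorem integral_norm_sq_mul_isoNormalPDF (hv : 0 < v) :
    ∫ x : EuclideanSpace ℝ (Fin d), ‖x‖ ^ 2 * isoNormalPDF d v x = d * v := by
  have hstein := isSteinFunction_one.integral_inner hv (0 : EuclideanSpace ℝ (Fin d))
  simp only [sub_zero, real_inner_self_eq_norm_sq, mul_one, deriv_const, mul_zero, add_zero,
    integral_const_mul, integral_isoNormalPDF hv] at hstein
  rw [hstein, mul_comm]

theorem integrable_dist_sq_mul_isoNormalPDF (hv : 0 < v) (c μ : EuclideanSpace ℝ (Fin d)) :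
    Integrable fun x => ‖c - x‖ ^ 2 * isoNormalPDF d v (x - μ) := by
  refine integrable_mul_isoNormalPDF hv μ (C := 2 * ‖c‖ ^ 2 + 2)
    ((continuous_sub_left c).norm.pow 2).aestronglyMeasurable fun x => ?_
  rw [abs_of_nonneg (sq_nonneg _)]
  have htri := (pow_le_pow_left₀ (norm_nonneg _) (norm_sub_le c x) 2).trans add_sq_le
  linarith [mul_nonneg (sq_nonneg ‖c‖) (sq_nonneg ‖x‖)]

/-- By symmetry `‖m - x‖ ^ 2` may be replaced by its average with `‖m + x‖ ^ 2`, which is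
`‖m‖ ^ 2 + ‖x‖ ^ 2`. -/
theorem integral_norm_sub_sq_mul_isoNormalPDF (hv : 0 < v) (m : EuclideanSpace ℝ (Fin d)) :
    ∫ x, ‖m - x‖ ^ 2 * isoNormalPDF d v x = ‖m‖ ^ 2 + d * v := by
  have hint : Integrable fun x => ‖m - x‖ ^ 2 * isoNormalPDF d v x := by
    simpa only [sub_zero] using integrable_dist_sq_mul_isoNormalPDF hv m 0
  have hint_neg : Integrable fun x => ‖m + x‖ ^ 2 * isoNormalPDF d v x := by
    simpa only [sub_neg_eq_add, isoNormalPDF_neg] using hint.comp_neg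
  have hsymm : ∫ x, ‖m + x‖ ^ 2 * isoNormalPDF d v x = ∫ x, ‖m - x‖ ^ 2 * isoNormalPDF d v x := by
    rw [← integral_neg_eq_self]
    simp only [← sub_eq_add_neg, isoNormalPDF_neg]
  have hparallelogram (x : EuclideanSpace ℝ (Fin d)) :
      ‖m + x‖ ^ 2 * isoNormalPDF d v x + ‖m - x‖ ^ 2 * isoNormalPDF d v x =
        2 * (‖m‖ ^ 2 * isoNormalPDF d v x + ‖x‖ ^ 2 * isoNormalPDF d v x) := by
    linear_combination isoNormalPDF d v x * parallelogram_law_with_norm ℝ m x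
  have hsum := integral_add hint_neg hint
  simp only [hparallelogram] at hsum
  rw [hsymm, integral_const_mul, integral_add ((integrable_isoNormalPDF hv).const_mul _)
    (integrable_norm_sq_mul_isoNormalPDF hv), integral_const_mul, integral_isoNormalPDF hv,
    integral_norm_sq_mul_isoNormalPDF hv] at hsum
  linarith

theorem integral_dist_sq_mul_isoNormalPDF (hv : 0 < v) (c μ : EuclideanSpace ℝ (Fin d)) :
    ∫ x, ‖c - x‖ ^ 2 * isoNormalPDF d v (x - μ) = ‖c - μ‖ ^ 2 + d * v := by
  rw [← integral_norm_sub_sq_mul_isoNormalPDF hv,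
    ← integral_sub_right_eq_self (fun x => ‖c - μ - x‖ ^ 2 * isoNormalPDF d v x) μ]
  simp only [sub_sub_sub_cancel_right]

theorem lintegral_isoNormalPDF (hv : 0 < v) (μ : EuclideanSpace ℝ (Fin d)) :
    ∫⁻ x, ENNReal.ofReal (isoNormalPDF d v (x - μ)) = 1 := by
  rw [← ofReal_integral_eq_lintegral_ofReal ((integrable_isoNormalPDF hv).comp_sub_right μ)
    (Eventually.of_forall fun x => (isoNormalPDF_pos hv _).le),
    integral_sub_right_eq_self (fun x => isoNormalPDF d v x), integral_isoNormalPDF hv,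
    ENNReal.ofReal_one]

theorem lintegral_dist_sq_mul_isoNormalPDF (hv : 0 < v) (c μ : EuclideanSpace ℝ (Fin d)) :
    ∫⁻ x, ENNReal.ofReal (‖c - x‖ ^ 2 * isoNormalPDF d v (x - μ)) =
      ENNReal.ofReal (‖c - μ‖ ^ 2 + d * v) := by
  rw [← ofReal_integral_eq_lintegral_ofReal (integrable_dist_sq_mul_isoNormalPDF hv c μ)
    (Eventually.of_forall fun x => mul_nonneg (sq_nonneg _) (isoNormalPDF_pos hv _).le),
    integral_dist_sq_mul_isoNormalPDF hv]

/-- Completing the square: with the prior `N(0, τ I)` on `θ`, the left-hand side is the joint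
density of `(x, θ)`, and the right-hand side is the marginal density of `x` times the posterior one
of `θ`. -/
theorem isoNormalPDF_mul_isoNormalPDF {τ : ℝ} (hv : 0 < v) (hτ : 0 < τ)
    (x θ : EuclideanSpace ℝ (Fin d)) :
    isoNormalPDF d v (x - θ) * isoNormalPDF d τ θ =
      isoNormalPDF d (v + τ) x *
        isoNormalPDF d (v * τ / (v + τ)) (θ - (τ / (v + τ)) • x) := by
  unfold isoNormalPDF
  rw [mul_mul_mul_comm, mul_mul_mul_comm ((2 * Real.pi * (v + τ)) ^ (-(d : ℝ) / 2)),
    ← Real.mul_rpow (by positivity) (by positivity),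
    ← Real.mul_rpow (by positivity) (by positivity), ← Real.exp_add, ← Real.exp_add,
    norm_sub_sq_real, norm_sub_sq_real, norm_smul, mul_pow,
    Real.norm_of_nonneg (show 0 ≤ τ / (v + τ) by positivity), inner_smul_right,
    real_inner_comm x θ]
  congr 2
  · field_simp
  · field_simp
    ring

end Gaussian

/-- The sample space of `(X, Z)`. -/
abbrev SampleSpace (p n : ℕ) : Type :=
  EuclideanSpace ℝ (Fin p) × EuclideanSpace ℝ (Fin n)

/-- The statistic `W = ‖X‖² / ‖Z‖²`, with value `0` where `Z = 0`. -/
noncomputable def normSqRatio {p n : ℕ} (y : SampleSpace p n) : ℝ := ‖y.1‖ ^ 2 / ‖y.2‖ ^ 2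

section SampleSpace

variable {p n : ℕ} {v : ℝ}

theorem ae_ne_zero_euclidean (hn : 1 ≤ n) : ∀ᵐ z : EuclideanSpace ℝ (Fin n), z ≠ 0 := by
  have : Nonempty (Fin n) := ⟨⟨0, hn⟩⟩
  exact compl_mem_ae_iff.2 (measure_singleton (0 : EuclideanSpace ℝ (Fin n)))

theorem ae_fst_ne_zero (hp : 1 ≤ p) : ∀ᵐ y : SampleSpace p n, y.1 ≠ 0 :=
  Measure.quasiMeasurePreserving_fst.ae (ae_ne_zero_euclidean hp)

theorem ae_snd_ne_zero (hn : 1 ≤ n) : ∀ᵐ y : SampleSpace p n, y.2 ≠ 0 :=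
  Measure.quasiMeasurePreserving_snd.ae (ae_ne_zero_euclidean hn)

theorem measurable_normSqRatio : Measurable (normSqRatio (p := p) (n := n)) := by
  unfold normSqRatio
  fun_prop

theorem normSqRatio_nonneg (y : SampleSpace p n) : 0 ≤ normSqRatio y := by
  unfold normSqRatio
  positivity

theorem normSqRatio_pos {y : SampleSpace p n} (hx : y.1 ≠ 0) (hz : y.2 ≠ 0) :
    0 < normSqRatio y := by
  unfold normSqRatio
  positivity

theorem likelihood_pos (hv : 0 < v) (θ : EuclideanSpace ℝ (Fin p)) (y : SampleSpace p n) :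
    0 < likelihood p n θ v y :=
  mul_pos (isoNormalPDF_pos hv _) (isoNormalPDF_pos hv _)

theorem continuous_likelihood_uncurry (v : ℝ) :
    Continuous fun t : EuclideanSpace ℝ (Fin p) × SampleSpace p n => likelihood p n t.1 v t.2 :=
  ((continuous_isoNormalPDF v).comp (by fun_prop)).mul
    ((continuous_isoNormalPDF v).comp (by fun_prop))

theorem continuous_likelihood (θ : EuclideanSpace ℝ (Fin p)) (v : ℝ) :
    Continuous (likelihood p n θ v) :=
  (continuous_likelihood_uncurry v).comp (f := fun y => (θ, y)) (by fun_prop)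

theorem integrable_mul_likelihood (hv : 0 < v) (θ : EuclideanSpace ℝ (Fin p))
    {f : SampleSpace p n → ℝ} (hf : Measurable f) {C : ℝ}
    (hC : ∀ y, |f y| ≤ C * (1 + ‖y.1‖ ^ 2)) : Integrable fun y => f y * likelihood p n θ v y := by
  have hdom_fst : Integrable fun x : EuclideanSpace ℝ (Fin p) =>
      (C * (1 + ‖x‖ ^ 2)) * isoNormalPDF p v (x - θ) := by
    refine integrable_mul_isoNormalPDF hv θ (C := |C|)
      (by fun_prop : Continuous fun x : EuclideanSpace ℝ (Fin p) =>
        C * (1 + ‖x‖ ^ 2)).aestronglyMeasurable fun x => ?_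
    rw [abs_mul, abs_of_pos (by positivity : 0 < 1 + ‖x‖ ^ 2)]
  refine (hdom_fst.mul_prod (integrable_isoNormalPDF (d := n) hv)).mono'
    (hf.mul (continuous_likelihood θ v).measurable).aestronglyMeasurable
    (Eventually.of_forall fun y => ?_)
  have hpos := likelihood_pos hv θ y
  rw [norm_mul, Real.norm_eq_abs, Real.norm_of_nonneg hpos.le]
  calc |f y| * likelihood p n θ v y ≤ (C * (1 + ‖y.1‖ ^ 2)) * likelihood p n θ v y := by
        gcongr
        exact hC y
    _ = _ := (mul_assoc _ _ _).symm

theorem integrable_mul_likelihood_of_bounded (hv : 0 < v) (θ : EuclideanSpace ℝ (Fin p))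
    {f : SampleSpace p n → ℝ} (hf : Measurable f) {C : ℝ} (hC : ∀ y, |f y| ≤ C) :
    Integrable fun y => f y * likelihood p n θ v y :=
  integrable_mul_likelihood hv θ hf fun y => (hC y).trans <|
    le_mul_of_one_le_right ((abs_nonneg _).trans (hC y)) (by linarith [sq_nonneg ‖y.1‖])

theorem integrable_dist_sq_mul_likelihood (hv : 0 < v) (θ : EuclideanSpace ℝ (Fin p)) :
    Integrable fun y : SampleSpace p n => ‖y.1 - θ‖ ^ 2 * likelihood p n θ v y := by
  refine integrable_mul_likelihood hv θ (C := 2 + 2 * ‖θ‖ ^ 2) (by fun_prop) fun y => ?_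
  rw [abs_of_nonneg (sq_nonneg _)]
  have htri := (pow_le_pow_left₀ (norm_nonneg _) (norm_sub_le y.1 θ) 2).trans add_sq_le
  linarith [mul_nonneg (sq_nonneg ‖y.1‖) (sq_nonneg ‖θ‖)]

theorem integral_dist_sq_mul_likelihood (hv : 0 < v) (θ : EuclideanSpace ℝ (Fin p)) :
    ∫ y : SampleSpace p n, ‖y.1 - θ‖ ^ 2 * likelihood p n θ v y = p * v := by
  simp only [likelihood, ← mul_assoc]
  rw [Measure.volume_eq_prod, integral_prod_mul
    (fun x : EuclideanSpace ℝ (Fin p) => ‖x - θ‖ ^ 2 * isoNormalPDF p v (x - θ))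
    (isoNormalPDF n v), integral_isoNormalPDF hv, mul_one]
  simpa only [norm_sub_rev, sub_self, norm_zero, zero_pow two_ne_zero, zero_add] using
    integral_dist_sq_mul_isoNormalPDF hv θ θ

end SampleSpace

theorem mul_deriv_comp_div_const (g : ℝ → ℝ) (s r : ℝ) :
    r * deriv (fun r => g (r / s)) r = r / s * deriv g (r / s) := by
  simp only [div_eq_inv_mul, deriv_comp_mul_left, smul_eq_mul]
  ring

namespace IsSteinFunction

variable {p n : ℕ} {C v : ℝ} {g : ℝ → ℝ}

theorem measurable_comp_normSqRatio (hg : IsSteinFunction C g) :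
    Measurable fun y : SampleSpace p n => g (normSqRatio y) :=
  hg.continuousOn.domRestrict.measurable.comp
    (measurable_normSqRatio.subtype_mk (h := normSqRatio_nonneg))

theorem integrable_inner_mul_likelihood (hg : IsSteinFunction C g) (hv : 0 < v)
    (θ : EuclideanSpace ℝ (Fin p)) :
    Integrable fun y : SampleSpace p n =>
      inner ℝ y.1 (y.1 - θ) * g (normSqRatio y) * likelihood p n θ v y := by
  refine integrable_mul_likelihood hv θ (C := (1 + ‖θ‖) * C)
    ((by fun_prop : Measurable fun y : SampleSpace p n => inner ℝ y.1 (y.1 - θ)).mul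
      hg.measurable_comp_normSqRatio) fun y => ?_
  have hinner : |inner ℝ y.1 (y.1 - θ)| ≤ (1 + ‖θ‖) * (1 + ‖y.1‖ ^ 2) := by
    have hnorm : ‖y.1‖ ≤ 1 + ‖y.1‖ ^ 2 := by nlinarith [sq_nonneg (‖y.1‖ - 1)]
    calc |inner ℝ y.1 (y.1 - θ)| ≤ ‖y.1‖ * (‖y.1‖ + ‖θ‖) :=
          (abs_real_inner_le_norm _ _).trans (by gcongr; exact norm_sub_le _ _)
      _ ≤ (1 + ‖θ‖) * (1 + ‖y.1‖ ^ 2) := by nlinarith [norm_nonneg θ]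
  rw [abs_mul, mul_right_comm]
  exact mul_le_mul hinner (hg.abs_le _ (normSqRatio_nonneg y)) (abs_nonneg _) (by positivity)

theorem integrable_div_fst_mul_likelihood (hg : IsSteinFunction C g) (hv : 0 < v)
    (θ : EuclideanSpace ℝ (Fin p)) :
    Integrable fun y : SampleSpace p n =>
      (p * g (normSqRatio y) + 2 * (normSqRatio y * deriv g (normSqRatio y))) *
        likelihood p n θ v y := by
  refine integrable_mul_likelihood_of_bounded hv θ (C := p * C + 2 * C)
    ((hg.measurable_comp_normSqRatio.const_mul _).add ((measurable_normSqRatio.mul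
      ((measurable_deriv g).comp measurable_normSqRatio)).const_mul 2)) fun y => ?_
  refine (abs_add_le _ _).trans ?_
  rw [abs_mul, abs_mul 2, abs_two, Nat.abs_cast]
  gcongr
  · exact hg.abs_le _ (normSqRatio_nonneg y)
  · exact hg.abs_mul_deriv_le _ (normSqRatio_nonneg y)

theorem comp_div_const (hg : IsSteinFunction C g) {s : ℝ} (hs : 0 < s) :
    IsSteinFunction C fun r => g (r / s) where
  continuousWithinAt_zero :=
    (hg.continuousOn.comp (continuous_id.div_const s).continuousOn
      fun _ hr => div_nonneg hr hs.le) 0 self_mem_Ici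
  differentiableAt r hr :=
    (hg.differentiableAt _ (div_pos hr hs)).comp r (differentiableAt_id.div_const s)
  abs_le r hr := hg.abs_le _ (div_nonneg hr hs.le)
  abs_mul_deriv_le r hr := by
    rw [mul_deriv_comp_div_const]
    exact hg.abs_mul_deriv_le _ (div_nonneg hr hs.le)

/-- Stein's identity in `X`, conditionally on `Z`. -/
theorem integral_inner_mul_likelihood (hg : IsSteinFunction C g) (hn : 1 ≤ n) (hv : 0 < v)
    (θ : EuclideanSpace ℝ (Fin p)) :
    ∫ y : SampleSpace p n, inner ℝ y.1 (y.1 - θ) * g (normSqRatio y) * likelihood p n θ v y =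
      v * ∫ y : SampleSpace p n,
        (p * g (normSqRatio y) + 2 * (normSqRatio y * deriv g (normSqRatio y))) *
          likelihood p n θ v y := by
  have hint := hg.integrable_inner_mul_likelihood (n := n) hv θ
  have hint_div := hg.integrable_div_fst_mul_likelihood (n := n) hv θ
  rw [Measure.volume_eq_prod] at hint hint_div ⊢
  rw [integral_prod_symm _ hint, integral_prod_symm _ hint_div, ← integral_const_mul]
  refine integral_congr_ae ?_
  filter_upwards [ae_ne_zero_euclidean hn] with z hz
  have hstein := (hg.comp_div_const (by positivity : 0 < ‖z‖ ^ 2)).integral_inner hv θ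
  simp only [mul_deriv_comp_div_const] at hstein
  simp only [likelihood, normSqRatio, ← mul_assoc _ (isoNormalPDF p v _)]
  rw [integral_mul_const, integral_mul_const, hstein, mul_assoc]

end IsSteinFunction

/-- The shrinkage factors `g` of the estimators `(1 - g W) X` to which the unbiased risk estimate
applies: the weight `g` is a Stein function, and so is its pullback along `s ↦ 1 / s`, because
`w * g w` is bounded. -/
structure IsShrinkageFactor (C : ℝ) (g : ℝ → ℝ) : Prop extends IsSteinFunction C g where
  abs_mul_le : ∀ w, 0 ≤ w → |w * g w| ≤ C

namespace IsShrinkageFactor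

variable {p n : ℕ} {C v : ℝ} {g : ℝ → ℝ}

theorem abs_self_mul_le (hg : IsShrinkageFactor C g) {w : ℝ} (hw : 0 ≤ w) :
    |g w * (w * g w)| ≤ C ^ 2 := by
  rw [abs_mul, sq]
  exact mul_le_mul (hg.abs_le w hw) (hg.abs_mul_le w hw) (abs_nonneg _) hg.nonneg

theorem abs_mul_mul_deriv_le (hg : IsShrinkageFactor C g) {w : ℝ} (hw : 0 ≤ w) :
    |w * g w * (w * deriv g w)| ≤ C ^ 2 := by
  rw [abs_mul, sq]
  exact mul_le_mul (hg.abs_mul_le w hw) (hg.abs_mul_deriv_le w hw) (abs_nonneg _) hg.nonneg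

theorem continuousWithinAt_inversion (hg : IsShrinkageFactor C g) {a : ℝ} (ha : 0 < a) :
    ContinuousWithinAt (fun s => g (a / s) * (a / s * g (a / s))) (Ici 0) 0 := by
  have hbound {s : ℝ} (hs : 0 ≤ s) : |g (a / s) * (a / s * g (a / s))| ≤ C ^ 2 / a * s := by
    rcases hs.eq_or_lt with rfl | hs
    · simp only [div_zero, zero_mul, mul_zero, abs_zero, le_refl]
    · have heq : g (a / s) * (a / s * g (a / s)) = (a / s * g (a / s)) ^ 2 / a * s := by
        field_simp
      rw [heq, abs_of_nonneg (by positivity), ← sq_abs (_ * _)]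
      gcongr
      exact hg.abs_mul_le _ (by positivity)
  have hlim : Tendsto (fun s : ℝ => C ^ 2 / a * s) (𝓝[Ici 0] 0) (𝓝 0) := by
    simpa only [mul_zero] using
      ((continuous_const_mul (C ^ 2 / a)).tendsto 0).mono_left nhdsWithin_le_nhds
  simpa only [ContinuousWithinAt, div_zero, zero_mul, mul_zero] using
    squeeze_zero_norm' (eventually_mem_nhdsWithin.mono fun s hs => hbound (mem_Ici.1 hs)) hlim

theorem hasDerivAt_inversion (hg : IsShrinkageFactor C g) {a s : ℝ} (ha : 0 < a) (hs : 0 < s) :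
    HasDerivAt (fun s => g (a / s) * (a / s * g (a / s)))
      (-(2 * (g (a / s) * (a / s * deriv g (a / s))) + g (a / s) * g (a / s)) * (a / s ^ 2)) s := by
  have hdiv : HasDerivAt (fun s : ℝ => a / s) (-(a / s ^ 2)) s := by
    simpa only [div_eq_mul_inv, mul_neg] using (hasDerivAt_inv hs.ne').const_mul a
  have hcomp := (hg.differentiableAt _ (div_pos ha hs)).hasDerivAt.comp s hdiv
  refine (hcomp.mul (hdiv.mul hcomp)).congr_deriv ?_
  simp only [Function.comp_apply, Pi.mul_apply]
  ring

theorem mul_deriv_inversion (hg : IsShrinkageFactor C g) {a s : ℝ} (ha : 0 < a) (hs : 0 < s) :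
    s * deriv (fun s => g (a / s) * (a / s * g (a / s))) s =
      -(2 * (a / s * g (a / s) * (a / s * deriv g (a / s))) +
        g (a / s) * (a / s * g (a / s))) := by
  rw [(hg.hasDerivAt_inversion ha hs).deriv]
  field_simp

theorem isSteinFunction_inversion (hg : IsShrinkageFactor C g) {a : ℝ} (ha : 0 < a) :
    IsSteinFunction (3 * C ^ 2) fun s => g (a / s) * (a / s * g (a / s)) where
  continuousWithinAt_zero := hg.continuousWithinAt_inversion ha
  differentiableAt s hs := (hg.hasDerivAt_inversion ha hs).differentiableAt
  abs_le s hs := (hg.abs_self_mul_le (by positivity)).trans (by linarith [sq_nonneg C])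
  abs_mul_deriv_le s hs := by
    rcases hs.eq_or_lt with rfl | hs
    · rw [zero_mul, abs_zero]
      positivity
    · rw [hg.mul_deriv_inversion ha hs, abs_neg]
      refine (abs_add_le _ _).trans ?_
      rw [abs_mul 2, abs_two]
      linarith [hg.abs_mul_mul_deriv_le (by positivity : 0 ≤ a / s),
        hg.abs_self_mul_le (by positivity : 0 ≤ a / s)]

theorem integrable_norm_sq_mul_likelihood (hg : IsShrinkageFactor C g) (hv : 0 < v)
    (θ : EuclideanSpace ℝ (Fin p)) :
    Integrable fun y : SampleSpace p n =>
      g (normSqRatio y) ^ 2 * ‖y.1‖ ^ 2 * likelihood p n θ v y := by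
  refine integrable_mul_likelihood hv θ (C := C ^ 2)
    ((hg.measurable_comp_normSqRatio.pow_const 2).mul (by fun_prop)) fun y => ?_
  rw [abs_of_nonneg (by positivity), ← sq_abs (g _)]
  gcongr
  · exact hg.abs_le _ (normSqRatio_nonneg y)
  · linarith

theorem integrable_div_snd_mul_likelihood (hg : IsShrinkageFactor C g) (hv : 0 < v)
    (θ : EuclideanSpace ℝ (Fin p)) :
    Integrable fun y : SampleSpace p n =>
      ((n - 2) * (g (normSqRatio y) * (normSqRatio y * g (normSqRatio y))) -
        4 * (normSqRatio y * g (normSqRatio y) *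
          (normSqRatio y * deriv g (normSqRatio y)))) * likelihood p n θ v y := by
  have hW := measurable_normSqRatio (p := p) (n := n)
  have hgW := hg.measurable_comp_normSqRatio (p := p) (n := n)
  have hdW := (measurable_deriv g).comp hW
  refine integrable_mul_likelihood_of_bounded hv θ (C := |(n : ℝ) - 2| * C ^ 2 + 4 * C ^ 2)
    (((hgW.mul (hW.mul hgW)).const_mul _).sub
      (((hW.mul hgW).mul (hW.mul hdW)).const_mul 4)) fun y => ?_
  refine (abs_sub _ _).trans ?_
  rw [abs_mul (_ - _), abs_mul 4, abs_of_pos (zero_lt_four' ℝ)]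
  gcongr
  · exact hg.abs_self_mul_le (normSqRatio_nonneg y)
  · exact hg.abs_mul_mul_deriv_le (normSqRatio_nonneg y)

theorem integral_sq_mul_isoNormalPDF (hg : IsShrinkageFactor C g) (hn : 1 ≤ n) (hv : 0 < v)
    {a : ℝ} (ha : 0 < a) :
    ∫ z : EuclideanSpace ℝ (Fin n), g (a / ‖z‖ ^ 2) ^ 2 * a * isoNormalPDF n v z =
      v * ∫ z : EuclideanSpace ℝ (Fin n),
        ((n - 2) * (g (a / ‖z‖ ^ 2) * (a / ‖z‖ ^ 2 * g (a / ‖z‖ ^ 2))) -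
          4 * (a / ‖z‖ ^ 2 * g (a / ‖z‖ ^ 2) * (a / ‖z‖ ^ 2 * deriv g (a / ‖z‖ ^ 2)))) *
          isoNormalPDF n v z := by
  have hstein := (hg.isSteinFunction_inversion ha).integral_inner hv (0 : EuclideanSpace ℝ (Fin n))
  simp only [sub_zero, real_inner_self_eq_norm_sq] at hstein
  refine (integral_congr_ae ?_).trans (hstein.trans (congrArg (v * ·) (integral_congr_ae ?_)))
  · filter_upwards [ae_ne_zero_euclidean hn] with z hz
    have hz' : ‖z‖ ≠ 0 := norm_ne_zero_iff.2 hz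
    field_simp
  · filter_upwards [ae_ne_zero_euclidean hn] with z hz
    rw [hg.mul_deriv_inversion ha (by positivity)]
    ring

/-- Stein's identity in `Z`, conditionally on `X`: with `S = ‖Z‖²` the integrand on the left is
`S * G S` for `G s = g (‖X‖² / s) ^ 2 * ‖X‖² / s`. -/
theorem integral_norm_sq_mul_likelihood (hg : IsShrinkageFactor C g) (hp : 1 ≤ p) (hn : 1 ≤ n)
    (hv : 0 < v) (θ : EuclideanSpace ℝ (Fin p)) :
    ∫ y : SampleSpace p n, g (normSqRatio y) ^ 2 * ‖y.1‖ ^ 2 * likelihood p n θ v y =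
      v * ∫ y : SampleSpace p n,
        ((n - 2) * (g (normSqRatio y) * (normSqRatio y * g (normSqRatio y))) -
          4 * (normSqRatio y * g (normSqRatio y) *
            (normSqRatio y * deriv g (normSqRatio y)))) * likelihood p n θ v y := by
  have hint := hg.integrable_norm_sq_mul_likelihood (n := n) hv θ
  have hint_div := hg.integrable_div_snd_mul_likelihood (n := n) hv θ
  rw [Measure.volume_eq_prod] at hint hint_div ⊢
  rw [integral_prod _ hint, integral_prod _ hint_div, ← integral_const_mul]
  refine integral_congr_ae ?_
  filter_upwards [ae_ne_zero_euclidean hp] with x hx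
  simp only [likelihood, normSqRatio, mul_left_comm _ (isoNormalPDF p v _)]
  rw [integral_const_mul, integral_const_mul,
    hg.integral_sq_mul_isoNormalPDF hn hv (by positivity), mul_left_comm]

end IsShrinkageFactor

section Risk

variable {p n : ℕ} {C v : ℝ} {g : ℝ → ℝ} {δ δ' : SampleSpace p n → EuclideanSpace ℝ (Fin p)}

theorem risk_eq_lintegral (hv : 0 < v) (hδ : Measurable δ) (θ : EuclideanSpace ℝ (Fin p)) :
    risk δ θ v = ∫⁻ y, ENNReal.ofReal (‖δ y - θ‖ ^ 2 * likelihood p n θ v y / v) := by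
  unfold risk model
  rw [lintegral_withDensity_eq_lintegral_mul _ (continuous_likelihood θ v).measurable.ennreal_ofReal
    (by unfold loss; fun_prop)]
  refine lintegral_congr fun y => ?_
  rw [Pi.mul_apply, loss, ← ENNReal.ofReal_mul (likelihood_pos hv θ y).le, mul_comm,
    div_mul_eq_mul_div]

theorem risk_congr_ae (h : δ =ᵐ[volume] δ') (θ : EuclideanSpace ℝ (Fin p)) (v : ℝ) :
    risk δ θ v = risk δ' θ v :=
  lintegral_congr_ae <| (h.filter_mono (withDensity_absolutelyContinuous _ _).ae_le).mono
    fun _ hy => congrArg (loss θ v) hy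

theorem norm_one_sub_smul_sub_sq_mul {E : Type*} [NormedAddCommGroup E] [InnerProductSpace ℝ E]
    (c l : ℝ) (x θ : E) :
    ‖(1 - c) • x - θ‖ ^ 2 * l =
      ‖x - θ‖ ^ 2 * l + c ^ 2 * ‖x‖ ^ 2 * l - 2 * (inner ℝ x (x - θ) * c * l) := by
  have hsplit : (1 - c) • x - θ = (x - θ) - c • x := by
    rw [sub_smul, one_smul]
    abel
  rw [hsplit, norm_sub_sq_real, inner_smul_right, norm_smul, mul_pow, Real.norm_eq_abs, sq_abs,
    real_inner_comm]
  ring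

namespace IsShrinkageFactor

theorem measurable_estimator (hg : IsShrinkageFactor C g) :
    Measurable fun y : SampleSpace p n => (1 - g (normSqRatio y)) • y.1 :=
  (hg.measurable_comp_normSqRatio.const_sub 1).smul measurable_fst

theorem integrable_estimator_dist_sq_mul_likelihood (hg : IsShrinkageFactor C g) (hv : 0 < v)
    (θ : EuclideanSpace ℝ (Fin p)) :
    Integrable fun y : SampleSpace p n =>
      ‖(1 - g (normSqRatio y)) • y.1 - θ‖ ^ 2 * likelihood p n θ v y := by
  simp only [norm_one_sub_smul_sub_sq_mul]
  exact ((integrable_dist_sq_mul_likelihood hv θ).add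
    (hg.integrable_norm_sq_mul_likelihood hv θ)).sub
      ((hg.integrable_inner_mul_likelihood hv θ).const_mul 2)

/-- Stein's unbiased risk estimate. -/
theorem integral_estimator_dist_sq_mul_likelihood (hg : IsShrinkageFactor C g) (hp : 1 ≤ p)
    (hn : 1 ≤ n) (hv : 0 < v) (θ : EuclideanSpace ℝ (Fin p)) :
    ∫ y : SampleSpace p n, ‖(1 - g (normSqRatio y)) • y.1 - θ‖ ^ 2 * likelihood p n θ v y =
      v * (p + (∫ y : SampleSpace p n,
          ((n - 2) * (g (normSqRatio y) * (normSqRatio y * g (normSqRatio y))) -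
            4 * (normSqRatio y * g (normSqRatio y) *
              (normSqRatio y * deriv g (normSqRatio y)))) * likelihood p n θ v y) -
        2 * ∫ y : SampleSpace p n,
          (p * g (normSqRatio y) + 2 * (normSqRatio y * deriv g (normSqRatio y))) *
            likelihood p n θ v y) := by
  have hdist := integrable_dist_sq_mul_likelihood (n := n) hv θ
  have hnorm := hg.integrable_norm_sq_mul_likelihood (n := n) hv θ
  have hinner := (hg.integrable_inner_mul_likelihood (n := n) hv θ).const_mul 2
  simp only [norm_one_sub_smul_sub_sq_mul]
  rw [integral_sub (hdist.fun_add hnorm) hinner, integral_add hdist hnorm, integral_const_mul,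
    integral_dist_sq_mul_likelihood hv, hg.integral_inner_mul_likelihood hn hv,
    hg.integral_norm_sq_mul_likelihood hp hn hv]
  ring

theorem risk_le (hg : IsShrinkageFactor C g) (hp : 1 ≤ p) (hn : 1 ≤ n)
    (hineq : ∀ w, 0 < w → (n - 2) * (g w * (w * g w)) - 4 * (w * g w * (w * deriv g w)) ≤
      2 * (p * g w + 2 * (w * deriv g w)))
    (hv : 0 < v) (θ : EuclideanSpace ℝ (Fin p)) :
    risk (fun y : SampleSpace p n => (1 - g (normSqRatio y)) • y.1) θ v ≤ p := by
  have hdiv : ∫ y : SampleSpace p n,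
        ((n - 2) * (g (normSqRatio y) * (normSqRatio y * g (normSqRatio y))) -
          4 * (normSqRatio y * g (normSqRatio y) *
            (normSqRatio y * deriv g (normSqRatio y)))) * likelihood p n θ v y ≤
      2 * ∫ y : SampleSpace p n,
        (p * g (normSqRatio y) + 2 * (normSqRatio y * deriv g (normSqRatio y))) *
          likelihood p n θ v y := by
    rw [← integral_const_mul]
    refine integral_mono_ae (hg.integrable_div_snd_mul_likelihood hv θ)
      ((hg.integrable_div_fst_mul_likelihood hv θ).const_mul 2) ?_
    filter_upwards [ae_fst_ne_zero hp, ae_snd_ne_zero hn] with y hx hz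
    rw [← mul_assoc 2]
    exact mul_le_mul_of_nonneg_right (hineq _ (normSqRatio_pos hx hz)) (likelihood_pos hv θ y).le
  rw [risk_eq_lintegral hv hg.measurable_estimator, ← ofReal_integral_eq_lintegral_ofReal
      ((hg.integrable_estimator_dist_sq_mul_likelihood hv θ).div_const v)
      (Eventually.of_forall fun y => by have := likelihood_pos hv θ y; positivity),
    integral_div, hg.integral_estimator_dist_sq_mul_likelihood hp hn hv,
    mul_div_cancel_left₀ _ hv.ne', ← ENNReal.ofReal_natCast p]
  exact ENNReal.ofReal_le_ofReal (by linarith)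

end IsShrinkageFactor

end Risk

section LowerBound

variable {p n : ℕ} {δ : SampleSpace p n → EuclideanSpace ℝ (Fin p)} {v τ : ℝ}

/-- The posterior under the prior `N(0, τ)` is normal with variance `v τ / (v + τ)` in each
coordinate, which bounds the posterior expected loss of any action from below. -/
theorem le_lintegral_dist_sq_mul_likelihood_mul_isoNormalPDF (hv : 0 < v) (hτ : 0 < τ)
    (d : EuclideanSpace ℝ (Fin p)) (y : SampleSpace p n) :
    ENNReal.ofReal (p * (v * τ / (v + τ))) *
        (ENNReal.ofReal (isoNormalPDF p (v + τ) y.1) * ENNReal.ofReal (isoNormalPDF n v y.2)) ≤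
      ∫⁻ θ, ENNReal.ofReal (‖d - θ‖ ^ 2 * likelihood p n θ v y * isoNormalPDF p τ θ) := by
  have hmarginal := isoNormalPDF_pos (add_pos hv hτ) y.1
  have hz := isoNormalPDF_pos hv y.2
  have hfactor (θ : EuclideanSpace ℝ (Fin p)) :
      ‖d - θ‖ ^ 2 * likelihood p n θ v y * isoNormalPDF p τ θ =
        isoNormalPDF p (v + τ) y.1 * isoNormalPDF n v y.2 *
          (‖d - θ‖ ^ 2 * isoNormalPDF p (v * τ / (v + τ)) (θ - (τ / (v + τ)) • y.1)) := by
    unfold likelihood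
    linear_combination ‖d - θ‖ ^ 2 * isoNormalPDF n v y.2 *
      isoNormalPDF_mul_isoNormalPDF hv hτ y.1 θ
  simp only [hfactor, ENNReal.ofReal_mul (mul_pos hmarginal hz).le]
  rw [lintegral_const_mul' _ _ ENNReal.ofReal_ne_top,
    lintegral_dist_sq_mul_isoNormalPDF (by positivity), mul_comm, ENNReal.ofReal_mul hmarginal.le]
  gcongr
  exact le_add_of_nonneg_left (sq_nonneg _)

theorem lintegral_risk_mul_isoNormalPDF_le_maxRisk (hv : 0 < v) (hτ : 0 < τ) :
    ∫⁻ θ, risk δ θ v * ENNReal.ofReal (isoNormalPDF p τ θ) ≤ maxRisk δ := by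
  calc ∫⁻ θ, risk δ θ v * ENNReal.ofReal (isoNormalPDF p τ θ)
      ≤ ∫⁻ θ, maxRisk δ * ENNReal.ofReal (isoNormalPDF p τ θ) := by
        gcongr with θ
        exact le_iSup_of_le θ (le_iSup_of_le v (le_iSup_of_le hv le_rfl))
    _ = maxRisk δ := by
        rw [lintegral_const_mul _ (continuous_isoNormalPDF τ).measurable.ennreal_ofReal]
        simpa only [sub_zero, mul_one] using
          congrArg (maxRisk δ * ·) (lintegral_isoNormalPDF (d := p) hτ 0)

theorem lintegral_risk_mul_isoNormalPDF (hδ : Measurable δ) :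
    ∫⁻ θ, risk δ θ 1 * ENNReal.ofReal (isoNormalPDF p τ θ) =
      ∫⁻ y, ∫⁻ θ,
        ENNReal.ofReal (‖δ y - θ‖ ^ 2 * likelihood p n θ 1 y * isoNormalPDF p τ θ) := by
  have hlik := (continuous_likelihood_uncurry (p := p) (n := n) 1).measurable
  have hpdf := (continuous_isoNormalPDF (d := p) τ).measurable
  rw [← lintegral_lintegral_swap (by fun_prop)]
  refine lintegral_congr fun θ => ?_
  have hlikθ := (continuous_likelihood (n := n) θ 1).measurable
  rw [risk_eq_lintegral one_pos hδ, ← lintegral_mul_const _ (by fun_prop)]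
  refine lintegral_congr fun y => ?_
  rw [div_one, ENNReal.ofReal_mul (mul_nonneg (sq_nonneg _) (likelihood_pos one_pos θ y).le)]

theorem ofReal_mul_div_one_add_le_maxRisk (hδ : Measurable δ) (hτ : 0 < τ) :
    ENNReal.ofReal (p * (1 * τ / (1 + τ))) ≤ maxRisk δ := by
  refine le_trans ?_ (lintegral_risk_mul_isoNormalPDF_le_maxRisk one_pos hτ)
  rw [lintegral_risk_mul_isoNormalPDF hδ]
  refine le_trans ?_ <| lintegral_mono fun y =>
    le_lintegral_dist_sq_mul_likelihood_mul_isoNormalPDF one_pos hτ (δ y) y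
  have hfst := lintegral_isoNormalPDF (d := p) (add_pos one_pos hτ) 0
  have hsnd := lintegral_isoNormalPDF (d := n) one_pos 0
  simp only [sub_zero] at hfst hsnd
  rw [lintegral_const_mul' _ _ ENNReal.ofReal_ne_top, Measure.volume_eq_prod,
    lintegral_prod_mul (f := fun x => ENNReal.ofReal (isoNormalPDF p (1 + τ) x))
      (g := fun z => ENNReal.ofReal (isoNormalPDF n 1 z))
      (continuous_isoNormalPDF _).measurable.ennreal_ofReal.aemeasurable
      (continuous_isoNormalPDF _).measurable.ennreal_ofReal.aemeasurable,
    hfst, hsnd, mul_one, mul_one]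

theorem le_maxRisk (hδ : Measurable δ) : (p : ENNReal) ≤ maxRisk δ := by
  have hlim : Tendsto (fun τ : ℝ => 1 * τ / (1 + τ)) atTop (𝓝 1) := by
    have hinv : Tendsto (fun τ : ℝ => 1 - (1 + τ)⁻¹) atTop (𝓝 (1 - 0)) :=
      (tendsto_inv_atTop_zero.comp (tendsto_atTop_add_const_left _ 1 tendsto_id)).const_sub 1
    rw [sub_zero] at hinv
    refine hinv.congr' ((eventually_gt_atTop 0).mono fun τ hτ => ?_)
    field_simp
    ring
  have hlim_ofReal := ENNReal.tendsto_ofReal (hlim.const_mul (p : ℝ))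
  rw [mul_one, ENNReal.ofReal_natCast] at hlim_ofReal
  exact le_of_tendsto hlim_ofReal
    ((eventually_gt_atTop 0).mono fun τ => ofReal_mul_div_one_add_le_maxRisk hδ)

end LowerBound

theorem IsShrinkageFactor.isMinimax {p n : ℕ} {C : ℝ} {g : ℝ → ℝ} (hg : IsShrinkageFactor C g)
    (hp : 1 ≤ p) (hn : 1 ≤ n)
    (hineq : ∀ w, 0 < w → (n - 2) * (g w * (w * g w)) - 4 * (w * g w * (w * deriv g w)) ≤
      2 * (p * g w + 2 * (w * deriv g w)))
    {δ : SampleSpace p n → EuclideanSpace ℝ (Fin p)} (hδ : Measurable δ)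
    (hδg : δ =ᵐ[volume] fun y => (1 - g (normSqRatio y)) • y.1) : IsMinimax δ := by
  refine ⟨hδ, fun δ' hδ' => le_trans ?_ (le_maxRisk hδ')⟩
  refine iSup_le fun θ => iSup_le fun v => iSup_le fun hv => ?_
  rw [risk_congr_ae hδg]
  exact hg.risk_le hp hn hineq hv θ

section HypergeometricShrinkage

variable {p n : ℕ} {b A N : ℝ}

theorem exists_isShrinkageFactor_hyperMean (hA : -1 < A) (hb : -1 < b) (hD : 0 < N - 2 - A) :
    ∃ C, IsShrinkageFactor C (hyperMean b A N) := by
  set B := (A + 1) / min (1 + b) (N - 2 - A)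
  have hB_nonneg : 0 ≤ B := div_nonneg (by linarith) (le_min (by linarith) hD.le)
  refine ⟨max 1 (max B (2 * |N|)), ⟨?_, fun w hw => ?_, fun w hw => ?_, fun w hw => ?_⟩,
    fun w hw => ?_⟩
  · exact ((hasDerivAt_hyperInt (by linarith) hb N neg_one_lt_zero).continuousAt.div
      (hasDerivAt_hyperInt hA hb N neg_one_lt_zero).continuousAt
      (hyperInt_pos hA hb N neg_one_lt_zero).ne').continuousWithinAt
  · exact (hasDerivAt_hyperMean hA hb N hw).differentiableAt
  · rw [abs_of_pos (hyperMean_pos hA hb N (by linarith))]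
    exact (hyperMean_lt_one hA hb N (by linarith)).le.trans (le_max_left _ _)
  · refine le_max_of_le_right (le_max_of_le_right ?_)
    rcases hw.eq_or_lt with rfl | hw
    · rw [zero_mul, abs_zero]
      positivity
    · exact abs_mul_deriv_hyperMean_le hA hb N hw
  · refine le_max_of_le_right (le_max_of_le_left ?_)
    rcases hw.eq_or_lt with rfl | hw
    · rwa [zero_mul, abs_zero]
    · exact (abs_of_pos (hyperPhi_pos hA hb N hw)).trans_le (hyperPhi_le hA hb hD hw)

theorem measurable_hyperMean (b A N : ℝ) : Measurable (hyperMean b A N) := by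
  have hint (A : ℝ) : Measurable (hyperInt b A N) := by
    have hweight : StronglyMeasurable fun q : ℝ × ℝ => hyperWeight b A N q.1 q.2 := by
      unfold hyperWeight
      exact Measurable.stronglyMeasurable (by fun_prop)
    exact (hweight.integral_prod_right' (ν := volume.restrict (Ioo (0 : ℝ) 1))).measurable
  exact (hint (A + 1)).div (hint A)

theorem measurable_hyperPhi (b A N : ℝ) : Measurable (hyperPhi b A N) :=
  measurable_id.mul (measurable_hyperMean b A N)

theorem measurable_shrinkageEstimator {f : ℝ → ℝ} (hf : Measurable f) :
    Measurable (shrinkageEstimator p n f) := by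
  unfold shrinkageEstimator
  fun_prop

theorem shrinkageEstimator_hyperPhi (b A N : ℝ) {y : SampleSpace p n} (hy : y.2 ≠ 0) :
    shrinkageEstimator p n (hyperPhi b A N) y =
      (1 - hyperMean b A N (normSqRatio y)) • y.1 := by
  rcases eq_or_ne y.1 0 with hx | hx
  · rw [shrinkageEstimator, hx, smul_zero, smul_zero]
  · rw [← mul_div_cancel_left₀ (hyperMean b A N (normSqRatio y)) (normSqRatio_pos hx hy).ne']
    rfl

theorem add_two_mul_cBound (p n : ℕ) : ((n : ℝ) + 2) * cBound p n = 2 * ((p : ℝ) - 2) :=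
  mul_div_cancel₀ _ (by positivity)

theorem isMinimax_of_ae_eq_shrinkageEstimator (hp : 1 ≤ p) (hn : 1 ≤ n) (hA : -1 < A)
    (hb : -1 < b) (hD : 0 < N - 2 - A)
    (hineq : ∀ w, 0 < w → (n + 2) * (hyperPhi b A N w * (hyperPhi b A N w - cBound p n)) ≤
      4 * (w * deriv (hyperPhi b A N) w) * (1 + hyperPhi b A N w))
    {δ : SampleSpace p n → EuclideanSpace ℝ (Fin p)} (hδ : Measurable δ)
    (hδφ : δ =ᵐ[volume] shrinkageEstimator p n (hyperPhi b A N)) : IsMinimax δ := by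
  obtain ⟨C, hC⟩ := exists_isShrinkageFactor_hyperMean hA hb hD
  refine hC.isMinimax hp hn (fun w hw => ?_) hδ ?_
  · have hderiv : deriv (hyperPhi b A N) w =
        1 * hyperMean b A N w + w * deriv (hyperMean b A N) w :=
      ((hasDerivAt_id w).mul (hC.differentiableAt w hw).hasDerivAt).deriv
    have hφ := hineq w hw
    rw [hderiv, hyperPhi] at hφ
    refine le_of_mul_le_mul_left ?_ hw
    linear_combination hφ + w * hyperMean b A N w * add_two_mul_cBound p n
  · filter_upwards [hδφ, ae_snd_ne_zero hn] with y hy hz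
    rw [hy, shrinkageEstimator_hyperPhi b A N hz]

end HypergeometricShrinkage

theorem phi_eq_hyperPhi (p n : ℕ) (a b e : ℝ) :
    phi p n a b e = hyperPhi b (p / 2 + a) (p / 2 + n / 2 + e + 2) := by
  ext w
  simp only [phi, hyperPhi, hyperMean, hyperInt, hyperWeight, mul_div_assoc]
  ring_nf

section HierarchicalPrior

variable {p n : ℕ} {a b e η t : ℝ}

/-- The density of `jointPrior p a b e` with respect to Lebesgue measure. -/
noncomputable def jointPriorDensity (p : ℕ) (a b e : ℝ) (q : EuclideanSpace ℝ (Fin p) × ℝ × ℝ) :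
    ℝ :=
  isoNormalPDF p (q.2.1⁻¹ * (1 - q.2.2) * q.2.2⁻¹) q.1 * q.2.1 ^ e *
    (q.2.2 ^ a * (1 - q.2.2) ^ b)

/-- The joint density of `η`, `λ = t` and the data, with `θ` integrated out: given `η` and `t`,
the observation `X` is centred normal with variance `(η t)⁻¹`. -/
noncomputable def mixingDensity (a b e : ℝ) (y : SampleSpace p n) (η t : ℝ) : ℝ :=
  isoNormalPDF p (η * t)⁻¹ y.1 * isoNormalPDF n η⁻¹ y.2 * η ^ e * (t ^ a * (1 - t) ^ b)

theorem measurable_jointPriorDensity (p : ℕ) (a b e : ℝ) :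
    Measurable (jointPriorDensity p a b e) := by
  unfold jointPriorDensity isoNormalPDF
  fun_prop

theorem measurable_likelihood_param (y : SampleSpace p n) :
    Measurable fun q : EuclideanSpace ℝ (Fin p) × ℝ => likelihood p n q.1 q.2⁻¹ y := by
  unfold likelihood isoNormalPDF
  fun_prop

theorem measurable_loss_param (d : EuclideanSpace ℝ (Fin p)) :
    Measurable fun q : EuclideanSpace ℝ (Fin p) × ℝ => loss q.1 q.2⁻¹ d := by
  unfold loss
  fun_prop

theorem jointPriorDensity_nonneg (a b e : ℝ) (hη : 0 < η) (ht : t ∈ Ioo (0 : ℝ) 1)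
    (θ : EuclideanSpace ℝ (Fin p)) : 0 ≤ jointPriorDensity p a b e (θ, η, t) := by
  have ht_pos := ht.1
  have ht_lt := sub_pos.2 ht.2
  have hpdf := isoNormalPDF_pos (v := η⁻¹ * (1 - t) * t⁻¹) (by positivity) θ
  unfold jointPriorDensity
  positivity

theorem mixingDensity_nonneg (a b e : ℝ) (hη : 0 < η) (ht : t ∈ Ioo (0 : ℝ) 1)
    (y : SampleSpace p n) : 0 ≤ mixingDensity a b e y η t := by
  have ht_pos := ht.1
  have ht_lt := sub_pos.2 ht.2
  have hpdf_fst := isoNormalPDF_pos (v := (η * t)⁻¹) (by positivity) y.1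
  have hpdf_snd := isoNormalPDF_pos (v := η⁻¹) (by positivity) y.2
  unfold mixingDensity
  positivity

theorem mul_mixingDensity (a b e : ℝ) (hη : 0 < η) (t : ℝ) (y : SampleSpace p n) :
    η * mixingDensity a b e y η t = mixingDensity a b (e + 1) y η t := by
  rw [mixingDensity, mixingDensity, Real.rpow_add_one hη.ne']
  ring

theorem lintegral_prior {f : EuclideanSpace ℝ (Fin p) × ℝ → ENNReal} (hf : Measurable f) :
    ∫⁻ q, f q ∂(prior p a b e) = ∫⁻ t in Ioo (0 : ℝ) 1, ∫⁻ η in Ioi (0 : ℝ), ∫⁻ θ,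
      ENNReal.ofReal (jointPriorDensity p a b e (θ, η, t)) * f (θ, η) := by
  have hdensity := (measurable_jointPriorDensity p a b e).ennreal_ofReal
  have hf' : Measurable fun q : EuclideanSpace ℝ (Fin p) × ℝ × ℝ => f (q.1, q.2.1) := by fun_prop
  have hprod : Measurable fun q : EuclideanSpace ℝ (Fin p) × ℝ × ℝ =>
      ENNReal.ofReal (jointPriorDensity p a b e q) * f (q.1, q.2.1) := hdensity.mul hf'
  have hprior : prior p a b e = ((volume.restrict (univ ×ˢ Ioi 0 ×ˢ Ioo 0 1)).withDensity
      fun q => ENNReal.ofReal (jointPriorDensity p a b e q)).map fun q => (q.1, q.2.1) := rfl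
  rw [hprior, lintegral_map hf (by fun_prop), lintegral_withDensity_eq_lintegral_mul _ hdensity hf',
    Measure.volume_eq_prod, Measure.volume_eq_prod, ← Measure.prod_restrict,
    ← Measure.prod_restrict, Measure.restrict_univ]
  simp only [Pi.mul_apply]
  rw [lintegral_prod_symm' _ hprod, lintegral_prod_symm' _ hprod.lintegral_prod_left']

/-- Given `η`, `t` and the data, `θ` is normal with mean `(1 - t) x` and variance
`η⁻¹ (1 - t)`. -/
theorem jointPriorDensity_mul_likelihood (a b e : ℝ) (hη : 0 < η) (ht : t ∈ Ioo (0 : ℝ) 1)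
    (y : SampleSpace p n) (θ : EuclideanSpace ℝ (Fin p)) :
    jointPriorDensity p a b e (θ, η, t) * likelihood p n θ η⁻¹ y =
      mixingDensity a b e y η t * isoNormalPDF p (η⁻¹ * (1 - t)) (θ - (1 - t) • y.1) := by
  have ht_pos := ht.1
  have ht_lt := sub_pos.2 ht.2
  have hpdf := isoNormalPDF_mul_isoNormalPDF (v := η⁻¹) (τ := η⁻¹ * (1 - t) * t⁻¹)
    (by positivity) (by positivity) y.1 θ
  have hsum : η⁻¹ + η⁻¹ * (1 - t) * t⁻¹ = (η * t)⁻¹ := by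
    field_simp
    ring
  have hvar : η⁻¹ * (η⁻¹ * (1 - t) * t⁻¹) / (η * t)⁻¹ = η⁻¹ * (1 - t) := by field_simp
  have hmean : η⁻¹ * (1 - t) * t⁻¹ / (η * t)⁻¹ = 1 - t := by field_simp
  rw [hsum, hvar, hmean] at hpdf
  unfold jointPriorDensity mixingDensity likelihood
  linear_combination (η ^ e * (t ^ a * (1 - t) ^ b) * isoNormalPDF n η⁻¹ y.2) * hpdf

theorem lintegral_jointPriorDensity_mul_likelihood_mul (a b e : ℝ) (hη : 0 < η)
    (ht : t ∈ Ioo (0 : ℝ) 1) (y : SampleSpace p n) (f : EuclideanSpace ℝ (Fin p) → ENNReal) :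
    ∫⁻ θ, ENNReal.ofReal (jointPriorDensity p a b e (θ, η, t)) *
        (ENNReal.ofReal (likelihood p n θ η⁻¹ y) * f θ) =
      ENNReal.ofReal (mixingDensity a b e y η t) * ∫⁻ θ,
        ENNReal.ofReal (isoNormalPDF p (η⁻¹ * (1 - t)) (θ - (1 - t) • y.1)) * f θ := by
  rw [← lintegral_const_mul' _ _ ENNReal.ofReal_ne_top]
  refine lintegral_congr fun θ => ?_
  rw [← mul_assoc, ← mul_assoc, ← ENNReal.ofReal_mul (jointPriorDensity_nonneg a b e hη ht θ),
    ← ENNReal.ofReal_mul (mixingDensity_nonneg a b e hη ht y),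
    jointPriorDensity_mul_likelihood a b e hη ht]

theorem lintegral_jointPriorDensity_mul_likelihood (a b e : ℝ) (hη : 0 < η)
    (ht : t ∈ Ioo (0 : ℝ) 1) (y : SampleSpace p n) :
    ∫⁻ θ, ENNReal.ofReal (jointPriorDensity p a b e (θ, η, t)) *
        ENNReal.ofReal (likelihood p n θ η⁻¹ y) = ENNReal.ofReal (mixingDensity a b e y η t) := by
  have h := lintegral_jointPriorDensity_mul_likelihood_mul a b e hη ht y fun _ => 1
  simp only [mul_one] at h
  rw [h, lintegral_isoNormalPDF (mul_pos (inv_pos.2 hη) (sub_pos.2 ht.2)), mul_one]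

theorem lintegral_jointPriorDensity_mul_likelihood_mul_loss (a b e : ℝ) (hη : 0 < η)
    (ht : t ∈ Ioo (0 : ℝ) 1) (y : SampleSpace p n) (d : EuclideanSpace ℝ (Fin p)) :
    ∫⁻ θ, ENNReal.ofReal (jointPriorDensity p a b e (θ, η, t)) *
        (ENNReal.ofReal (likelihood p n θ η⁻¹ y) * loss θ η⁻¹ d) =
      ENNReal.ofReal (‖d - (1 - t) • y.1‖ ^ 2 * mixingDensity a b (e + 1) y η t +
        p * mixingDensity a (b + 1) e y η t) := by
  have hv : 0 < η⁻¹ * (1 - t) := mul_pos (inv_pos.2 hη) (sub_pos.2 ht.2)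
  have hmix := mixingDensity_nonneg a b e hη ht y
  have hloss (θ : EuclideanSpace ℝ (Fin p)) :
      ENNReal.ofReal (isoNormalPDF p (η⁻¹ * (1 - t)) (θ - (1 - t) • y.1)) * loss θ η⁻¹ d =
        ENNReal.ofReal η * ENNReal.ofReal
          (‖d - θ‖ ^ 2 * isoNormalPDF p (η⁻¹ * (1 - t)) (θ - (1 - t) • y.1)) := by
    rw [loss, ← ENNReal.ofReal_mul (isoNormalPDF_pos hv _).le, ← ENNReal.ofReal_mul hη.le,
      div_inv_eq_mul]
    ring_nf
  rw [lintegral_jointPriorDensity_mul_likelihood_mul a b e hη ht]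
  simp only [hloss]
  rw [lintegral_const_mul' _ _ ENNReal.ofReal_ne_top, lintegral_dist_sq_mul_isoNormalPDF hv,
    ← ENNReal.ofReal_mul hη.le, ← ENNReal.ofReal_mul hmix, ← mul_mixingDensity a b e hη]
  congr 1
  rw [mixingDensity, mixingDensity, Real.rpow_add_one (sub_pos.2 ht.2).ne']
  field_simp

theorem lintegral_rpow_mul_exp_neg_mul {s r : ℝ} (hs : 0 < s) (hr : 0 < r) :
    ∫⁻ η in Ioi (0 : ℝ), ENNReal.ofReal (η ^ (s - 1) * Real.exp (-(r * η))) =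
      ENNReal.ofReal (r ^ (-s) * Real.Gamma s) := by
  have hvalue := Real.integral_rpow_mul_exp_neg_mul_Ioi hs hr
  have hpos : 0 < (1 / r) ^ s * Real.Gamma s :=
    mul_pos (Real.rpow_pos_of_pos (one_div_pos.2 hr) s) (Real.Gamma_pos_of_pos hs)
  have hint : IntegrableOn (fun η : ℝ => η ^ (s - 1) * Real.exp (-(r * η))) (Ioi 0) :=
    Integrable.of_integral_ne_zero (hvalue.trans_ne hpos.ne')
  rw [Real.rpow_neg hr.le, ← Real.inv_rpow hr.le, ← one_div, ← hvalue,
    ofReal_integral_eq_lintegral_ofReal hint]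
  filter_upwards [ae_restrict_mem measurableSet_Ioi] with η hη
  exact mul_nonneg (Real.rpow_nonneg (mem_Ioi.1 hη).le _) (Real.exp_nonneg _)

theorem isoNormalPDF_inv {d : ℕ} (hη : 0 < η) (x : EuclideanSpace ℝ (Fin d)) :
    isoNormalPDF d η⁻¹ x =
      (2 * Real.pi) ^ (-(d : ℝ) / 2) * η ^ ((d : ℝ) / 2) * Real.exp (-(η * ‖x‖ ^ 2 / 2)) := by
  rw [isoNormalPDF, Real.mul_rpow (by positivity) (by positivity), Real.inv_rpow hη.le,
    ← Real.rpow_neg hη.le, neg_div, neg_neg]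
  congr 2
  field_simp

/-- The constant that remains when `η` is integrated out of `mixingDensity`; it does not depend on
`λ`. -/
noncomputable def mixingConst (p n : ℕ) (e s : ℝ) : ℝ :=
  (2 * Real.pi) ^ (-(p : ℝ) / 2) * (2 * Real.pi) ^ (-(n : ℝ) / 2) *
    (s ^ (-(p / 2 + n / 2 + e + 1)) * Real.Gamma (p / 2 + n / 2 + e + 1))

theorem mixingConst_pos {s : ℝ} (he : 0 < (p : ℝ) / 2 + n / 2 + e + 1) (hs : 0 < s) :
    0 < mixingConst p n e s := by
  have := Real.Gamma_pos_of_pos he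
  unfold mixingConst
  positivity

theorem mixingDensity_eq (a b e : ℝ) (hη : 0 < η) (ht : 0 < t) {y : SampleSpace p n}
    (hy : y.2 ≠ 0) : mixingDensity a b e y η t =
      (2 * Real.pi) ^ (-(p : ℝ) / 2) * (2 * Real.pi) ^ (-(n : ℝ) / 2) *
        (t ^ ((p : ℝ) / 2 + a) * (1 - t) ^ b) * (η ^ ((p : ℝ) / 2 + n / 2 + e) *
          Real.exp (-(‖y.2‖ ^ 2 / 2 * (1 + normSqRatio y * t) * η))) := by
  have hexp : Real.exp (-(‖y.2‖ ^ 2 / 2 * (1 + normSqRatio y * t) * η)) =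
      Real.exp (-(η * t * ‖y.1‖ ^ 2 / 2)) * Real.exp (-(η * ‖y.2‖ ^ 2 / 2)) := by
    rw [← Real.exp_add, normSqRatio]
    congr 1
    field_simp
    ring
  rw [mixingDensity, isoNormalPDF_inv (mul_pos hη ht), isoNormalPDF_inv hη, hexp,
    Real.mul_rpow hη.le ht.le, Real.rpow_add hη, Real.rpow_add hη, Real.rpow_add ht]
  ring

theorem lintegral_mixingDensity (a b : ℝ) (he : 0 < (p : ℝ) / 2 + n / 2 + e + 1)
    (ht : t ∈ Ioo (0 : ℝ) 1) {y : SampleSpace p n} (hy : y.2 ≠ 0) :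
    ∫⁻ η in Ioi (0 : ℝ), ENNReal.ofReal (mixingDensity a b e y η t) =
      ENNReal.ofReal (mixingConst p n e (‖y.2‖ ^ 2 / 2) *
        hyperWeight b (p / 2 + a) (p / 2 + n / 2 + e + 1) (normSqRatio y) t) := by
  have ht_pos := ht.1
  have ht_lt := sub_pos.2 ht.2
  have hS : 0 < ‖y.2‖ ^ 2 / 2 := by positivity
  have hW : 0 < 1 + normSqRatio y * t := by have := normSqRatio_nonneg y; positivity
  have hsplit : EqOn (fun η => ENNReal.ofReal (mixingDensity a b e y η t)) (fun η =>
      ENNReal.ofReal ((2 * Real.pi) ^ (-(p : ℝ) / 2) * (2 * Real.pi) ^ (-(n : ℝ) / 2) *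
        (t ^ ((p : ℝ) / 2 + a) * (1 - t) ^ b)) *
      ENNReal.ofReal (η ^ ((p : ℝ) / 2 + n / 2 + e + 1 - 1) *
        Real.exp (-(‖y.2‖ ^ 2 / 2 * (1 + normSqRatio y * t) * η)))) (Ioi 0) := fun η hη => by
    simp only [mixingDensity_eq a b e hη ht_pos hy, add_sub_cancel_right]
    rw [← ENNReal.ofReal_mul (by positivity)]
  rw [setLIntegral_congr_fun measurableSet_Ioi hsplit,
    lintegral_const_mul' _ _ ENNReal.ofReal_ne_top,
    lintegral_rpow_mul_exp_neg_mul he (mul_pos hS hW), ← ENNReal.ofReal_mul (by positivity),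
    Real.mul_rpow hS.le hW.le, mixingConst, hyperWeight]
  ring_nf

theorem lintegral_mul_mixingDensity_add (a b : ℝ) (he : 0 < (p : ℝ) / 2 + n / 2 + e + 1)
    (ht : t ∈ Ioo (0 : ℝ) 1) {y : SampleSpace p n} (hy : y.2 ≠ 0) {u : ℝ} (hu : 0 ≤ u) :
    ∫⁻ η in Ioi (0 : ℝ), ENNReal.ofReal
        (u * mixingDensity a b (e + 1) y η t + p * mixingDensity a (b + 1) e y η t) =
      ENNReal.ofReal (mixingConst p n (e + 1) (‖y.2‖ ^ 2 / 2) *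
          (u * hyperWeight b (p / 2 + a) (p / 2 + n / 2 + e + 2) (normSqRatio y) t) +
        mixingConst p n e (‖y.2‖ ^ 2 / 2) *
          (p * hyperWeight (b + 1) (p / 2 + a) (p / 2 + n / 2 + e + 1) (normSqRatio y) t)) := by
  have hS : 0 < ‖y.2‖ ^ 2 / 2 := by positivity
  have he' : 0 < (p : ℝ) / 2 + n / 2 + (e + 1) + 1 := by linarith
  have hW : -1 < normSqRatio y := neg_one_lt_zero.trans_le (normSqRatio_nonneg y)
  have hK := mixingConst_pos he hS
  have hK' := mixingConst_pos he' hS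
  have hweight (b N : ℝ) := hyperWeight_pos b (p / 2 + a) N hW ht
  have hmeas : Measurable (mixingDensity a b (e + 1) y · t) := by
    unfold mixingDensity isoNormalPDF
    fun_prop
  have hsplit : EqOn
      (fun η => ENNReal.ofReal
        (u * mixingDensity a b (e + 1) y η t + p * mixingDensity a (b + 1) e y η t))
      (fun η => ENNReal.ofReal u * ENNReal.ofReal (mixingDensity a b (e + 1) y η t) +
        ENNReal.ofReal p * ENNReal.ofReal (mixingDensity a (b + 1) e y η t)) (Ioi 0) :=
    fun η hη => by
      have hmix (b e : ℝ) := mixingDensity_nonneg a b e hη ht y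
      simp only [ENNReal.ofReal_add (mul_nonneg hu (hmix _ _))
        (mul_nonneg p.cast_nonneg (hmix _ _)), ENNReal.ofReal_mul hu,
        ENNReal.ofReal_mul (Nat.cast_nonneg (α := ℝ) p)]
  rw [setLIntegral_congr_fun measurableSet_Ioi hsplit, lintegral_add_left (by fun_prop),
    lintegral_const_mul' _ _ ENNReal.ofReal_ne_top, lintegral_const_mul' _ _ ENNReal.ofReal_ne_top,
    lintegral_mixingDensity a b he' ht hy, lintegral_mixingDensity a (b + 1) he ht hy,
    ← ENNReal.ofReal_mul hu, ← ENNReal.ofReal_mul p.cast_nonneg, ← ENNReal.ofReal_add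
      (mul_nonneg hu (mul_pos hK' (hweight _ _)).le)
      (mul_nonneg p.cast_nonneg (mul_pos hK (hweight _ _)).le),
    show (p : ℝ) / 2 + n / 2 + (e + 1) + 1 = p / 2 + n / 2 + e + 2 by ring]
  ring_nf

theorem integrableOn_mul_hyperWeight {A w : ℝ} (hA : -1 < A) (hb : -1 < b) (N : ℝ) (hw : -1 < w)
    {f : ℝ → ℝ} (hf : Continuous f) :
    IntegrableOn (fun t => f t * hyperWeight b A N w t) (Ioo 0 1) :=
  (integrableOn_hyperWeight hA hb N hw).continuousOn_mul_of_subset hf.continuousOn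
    isCompact_Icc measurableSet_Ioo Ioo_subset_Icc_self

theorem integral_sub_hyperMean_mul_hyperWeight {A w : ℝ} (hA : -1 < A) (hb : -1 < b) (N : ℝ)
    (hw : -1 < w) :
    ∫ t in Ioo (0 : ℝ) 1, (t - hyperMean b A N w) * hyperWeight b A N w t = 0 := by
  have hsplit : EqOn (fun t => (t - hyperMean b A N w) * hyperWeight b A N w t)
      (fun t => hyperWeight b (A + 1) N w t - hyperMean b A N w * hyperWeight b A N w t)
      (Ioo 0 1) := fun t ht => by
    simp only [hyperWeight_add_one b A N w ht.1, sub_mul]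
  rw [setIntegral_congr_fun measurableSet_Ioo hsplit,
    integral_sub (integrableOn_hyperWeight (by linarith) hb N hw)
      ((integrableOn_hyperWeight hA hb N hw).const_mul _), integral_const_mul]
  exact sub_eq_zero.2 (hyperMean_mul_hyperInt hA hb N hw).symm

theorem integral_dist_sq_mul_hyperWeight {A w : ℝ} (hA : -1 < A) (hb : -1 < b) (N : ℝ)
    (hw : -1 < w) (d x : EuclideanSpace ℝ (Fin p)) :
    ∫ t in Ioo (0 : ℝ) 1, ‖d - (1 - t) • x‖ ^ 2 * hyperWeight b A N w t =
      ‖x‖ ^ 2 * (∫ t in Ioo (0 : ℝ) 1, (t - hyperMean b A N w) ^ 2 * hyperWeight b A N w t) +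
        hyperInt b A N w * ‖d - (1 - hyperMean b A N w) • x‖ ^ 2 := by
  set m := hyperMean b A N w with hm
  have hexpand (t : ℝ) : ‖d - (1 - t) • x‖ ^ 2 * hyperWeight b A N w t =
      ‖x‖ ^ 2 * ((t - m) ^ 2 * hyperWeight b A N w t) +
        2 * inner ℝ (d - (1 - m) • x) x * ((t - m) * hyperWeight b A N w t) +
        ‖d - (1 - m) • x‖ ^ 2 * hyperWeight b A N w t := by
    rw [show d - (1 - t) • x = (d - (1 - m) • x) + (t - m) • x by module, norm_add_sq_real,
      inner_smul_right, norm_smul, mul_pow, Real.norm_eq_abs, sq_abs]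
    ring
  have i₂ := (integrableOn_mul_hyperWeight hA hb N hw
    (by fun_prop : Continuous fun t => (t - m) ^ 2)).const_mul (‖x‖ ^ 2)
  have i₁ := (integrableOn_mul_hyperWeight hA hb N hw
    (by fun_prop : Continuous fun t => t - m)).const_mul (2 * inner ℝ (d - (1 - m) • x) x)
  have i₀ := (integrableOn_hyperWeight hA hb N hw).const_mul (‖d - (1 - m) • x‖ ^ 2)
  simp only [hexpand]
  rw [integral_add ?_ i₀, integral_add i₂ i₁, integral_const_mul, integral_const_mul,
    integral_const_mul, hm, integral_sub_hyperMean_mul_hyperWeight hA hb N hw, mul_zero, add_zero,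
    mul_comm (hyperInt b A N w)]
  · rfl
  · exact i₂.add i₁

theorem marginal_prior (hA : -1 < (p : ℝ) / 2 + a) (hb : -1 < b)
    (he : 0 < (p : ℝ) / 2 + n / 2 + e + 1) {y : SampleSpace p n} (hy : y.2 ≠ 0) :
    marginal (prior p a b e) y = ENNReal.ofReal (mixingConst p n e (‖y.2‖ ^ 2 / 2) *
      hyperInt b (p / 2 + a) (p / 2 + n / 2 + e + 1) (normSqRatio y)) := by
  have hK := mixingConst_pos he (show 0 < ‖y.2‖ ^ 2 / 2 by positivity)
  have hW : -1 < normSqRatio y := neg_one_lt_zero.trans_le (normSqRatio_nonneg y)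
  rw [marginal, lintegral_prior (measurable_likelihood_param y).ennreal_ofReal,
    setLIntegral_congr_fun measurableSet_Ioo fun t ht =>
      (setLIntegral_congr_fun measurableSet_Ioi fun η hη =>
        lintegral_jointPriorDensity_mul_likelihood a b e hη ht y).trans
        (lintegral_mixingDensity a b he ht hy),
    ← ofReal_integral_eq_lintegral_ofReal
      ((integrableOn_hyperWeight hA hb _ hW).const_mul _), integral_const_mul, hyperInt]
  filter_upwards [ae_restrict_mem measurableSet_Ioo] with t ht
  exact (mul_pos hK (hyperWeight_pos _ _ _ hW ht)).le

theorem lintegral_likelihood_mul_loss_prior (hA : -1 < (p : ℝ) / 2 + a) (hb : -1 < b)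
    (he : 0 < (p : ℝ) / 2 + n / 2 + e + 1) {y : SampleSpace p n} (hy : y.2 ≠ 0)
    (d : EuclideanSpace ℝ (Fin p)) :
    ∫⁻ q, ENNReal.ofReal (likelihood p n q.1 q.2⁻¹ y) * loss q.1 q.2⁻¹ d ∂(prior p a b e) =
      ENNReal.ofReal (mixingConst p n (e + 1) (‖y.2‖ ^ 2 / 2) *
          (∫ t in Ioo (0 : ℝ) 1, ‖d - (1 - t) • y.1‖ ^ 2 *
            hyperWeight b (p / 2 + a) (p / 2 + n / 2 + e + 2) (normSqRatio y) t) +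
        mixingConst p n e (‖y.2‖ ^ 2 / 2) *
          (p * hyperInt (b + 1) (p / 2 + a) (p / 2 + n / 2 + e + 1) (normSqRatio y))) := by
  have hS : 0 < ‖y.2‖ ^ 2 / 2 := by positivity
  have hK := mixingConst_pos he hS
  have hK' := mixingConst_pos (p := p) (n := n) (e := e + 1) (by linarith) hS
  have hW : -1 < normSqRatio y := neg_one_lt_zero.trans_le (normSqRatio_nonneg y)
  have hdist := (integrableOn_mul_hyperWeight hA hb ((p : ℝ) / 2 + n / 2 + e + 2) hW
    (by fun_prop : Continuous fun t : ℝ => ‖d - (1 - t) • y.1‖ ^ 2)).const_mul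
      (mixingConst p n (e + 1) (‖y.2‖ ^ 2 / 2))
  have hvar := ((integrableOn_hyperWeight hA (show -1 < b + 1 by linarith)
    ((p : ℝ) / 2 + n / 2 + e + 1) hW).const_mul (p : ℝ)).const_mul
      (mixingConst p n e (‖y.2‖ ^ 2 / 2))
  have hmeas : Measurable fun q : EuclideanSpace ℝ (Fin p) × ℝ =>
      ENNReal.ofReal (likelihood p n q.1 q.2⁻¹ y) * loss q.1 q.2⁻¹ d :=
    (measurable_likelihood_param y).ennreal_ofReal.mul (measurable_loss_param d)
  rw [lintegral_prior hmeas,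
    setLIntegral_congr_fun measurableSet_Ioo fun t ht =>
      (setLIntegral_congr_fun measurableSet_Ioi fun η hη =>
        lintegral_jointPriorDensity_mul_likelihood_mul_loss a b e hη ht y d).trans
        (lintegral_mul_mixingDensity_add a b he ht hy (sq_nonneg _)),
    ← ofReal_integral_eq_lintegral_ofReal (hdist.fun_add hvar), integral_add hdist hvar,
    integral_const_mul, integral_const_mul, integral_const_mul, hyperInt]
  filter_upwards [ae_restrict_mem measurableSet_Ioo] with t ht
  have hweight (b N : ℝ) := hyperWeight_pos b (p / 2 + a) N hW ht
  exact add_nonneg (mul_nonneg hK'.le (mul_nonneg (sq_nonneg _) (hweight _ _).le))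
    (mul_nonneg hK.le (mul_nonneg p.cast_nonneg (hweight _ _).le))

theorem posteriorLoss_eq (π : Measure (EuclideanSpace ℝ (Fin p) × ℝ)) (y : SampleSpace p n)
    (d : EuclideanSpace ℝ (Fin p)) :
    posteriorLoss π y d = (marginal π y)⁻¹ *
      ∫⁻ q, ENNReal.ofReal (likelihood p n q.1 q.2⁻¹ y) * loss q.1 q.2⁻¹ d ∂π := by
  rw [posteriorLoss, posterior, lintegral_smul_measure, smul_eq_mul,
    lintegral_withDensity_eq_lintegral_mul _ (measurable_likelihood_param y).ennreal_ofReal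
      (measurable_loss_param d)]
  rfl

theorem marginal_prior_ne_zero (hA : -1 < (p : ℝ) / 2 + a) (hb : -1 < b)
    (he : 0 < (p : ℝ) / 2 + n / 2 + e + 1) {y : SampleSpace p n} (hy : y.2 ≠ 0) :
    marginal (prior p a b e) y ≠ 0 := by
  rw [marginal_prior hA hb he hy]
  exact (ENNReal.ofReal_pos.2 (mul_pos (mixingConst_pos he (by positivity))
    (hyperInt_pos hA hb _ (neg_one_lt_zero.trans_le (normSqRatio_nonneg y))))).ne'

theorem marginal_prior_ne_top (hA : -1 < (p : ℝ) / 2 + a) (hb : -1 < b)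
    (he : 0 < (p : ℝ) / 2 + n / 2 + e + 1) {y : SampleSpace p n} (hy : y.2 ≠ 0) :
    marginal (prior p a b e) y ≠ ⊤ := by
  rw [marginal_prior hA hb he hy]
  exact ENNReal.ofReal_ne_top

theorem exists_posteriorLoss_prior_eq (hA : -1 < (p : ℝ) / 2 + a) (hb : -1 < b)
    (he : 0 < (p : ℝ) / 2 + n / 2 + e + 1) {y : SampleSpace p n} (hy : y.2 ≠ 0) :
    ∃ Q c : ℝ, 0 ≤ Q ∧ 0 < c ∧ ∀ d : EuclideanSpace ℝ (Fin p),
      posteriorLoss (prior p a b e) y d = ENNReal.ofReal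
        (Q + c * ‖d - shrinkageEstimator p n (phi p n a b e) y‖ ^ 2) := by
  have hS : 0 < ‖y.2‖ ^ 2 / 2 := by positivity
  have hW : -1 < normSqRatio y := neg_one_lt_zero.trans_le (normSqRatio_nonneg y)
  have hK := mixingConst_pos he hS
  have hK' := mixingConst_pos (p := p) (n := n) (e := e + 1) (by linarith) hS
  have hH := hyperInt_pos hA hb ((p : ℝ) / 2 + n / 2 + e + 1) hW
  have hH₁ := hyperInt_pos hA (show -1 < b + 1 by linarith) ((p : ℝ) / 2 + n / 2 + e + 1) hW
  have hH₂ := hyperInt_pos hA hb ((p : ℝ) / 2 + n / 2 + e + 2) hW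
  have hV := setIntegral_nonneg (μ := volume) (measurableSet_Ioo (a := (0 : ℝ)) (b := 1)) fun t ht
    => mul_nonneg (sq_nonneg (t - hyperMean b (p / 2 + a) (p / 2 + n / 2 + e + 2) (normSqRatio y)))
      (hyperWeight_pos b (p / 2 + a) (p / 2 + n / 2 + e + 2) hW ht).le
  rw [phi_eq_hyperPhi, shrinkageEstimator_hyperPhi _ _ _ hy]
  simp only [posteriorLoss_eq, marginal_prior hA hb he hy,
    lintegral_likelihood_mul_loss_prior hA hb he hy, integral_dist_sq_mul_hyperWeight hA hb _ hW]
  set M := mixingConst p n e (‖y.2‖ ^ 2 / 2) *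
    hyperInt b (p / 2 + a) (p / 2 + n / 2 + e + 1) (normSqRatio y)
  have hM : 0 < M := mul_pos hK hH
  refine ⟨M⁻¹ * (mixingConst p n (e + 1) (‖y.2‖ ^ 2 / 2) * (‖y.1‖ ^ 2 * _) +
      mixingConst p n e (‖y.2‖ ^ 2 / 2) * (p * _)),
    M⁻¹ * (mixingConst p n (e + 1) (‖y.2‖ ^ 2 / 2) * _),
    mul_nonneg (inv_pos.2 hM).le (add_nonneg (mul_nonneg hK'.le (mul_nonneg (sq_nonneg _) hV))
      (mul_nonneg hK.le (mul_nonneg p.cast_nonneg hH₁.le))),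
    mul_pos (inv_pos.2 hM) (mul_pos hK' hH₂), fun d => ?_⟩
  rw [← ENNReal.ofReal_inv_of_pos hM, ← ENNReal.ofReal_mul (inv_pos.2 hM).le]
  congr 1
  ring

theorem isGeneralizedBayes_shrinkageEstimator (hn : 1 ≤ n) (hA : -1 < (p : ℝ) / 2 + a)
    (hb : -1 < b) (he : 0 < (p : ℝ) / 2 + n / 2 + e + 1) :
    IsGeneralizedBayes (prior p a b e) (shrinkageEstimator p n (phi p n a b e)) := by
  refine ⟨measurable_shrinkageEstimator ?_, ?_⟩
  · rw [phi_eq_hyperPhi]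
    exact measurable_hyperPhi _ _ _
  · filter_upwards [ae_snd_ne_zero hn] with y hy
    obtain ⟨Q, c, -, hc, hloss⟩ := exists_posteriorLoss_prior_eq hA hb he hy
    refine ⟨marginal_prior_ne_zero hA hb he hy, marginal_prior_ne_top hA hb he hy,
      (hloss _).trans_ne ENNReal.ofReal_ne_top, fun d => ?_⟩
    rw [hloss, hloss, sub_self, norm_zero, zero_pow two_ne_zero, mul_zero, add_zero]
    exact ENNReal.ofReal_le_ofReal (le_add_of_nonneg_right (by positivity))

theorem IsGeneralizedBayes.ae_eq_shrinkageEstimator (hn : 1 ≤ n) (hA : -1 < (p : ℝ) / 2 + a)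
    (hb : -1 < b) (he : 0 < (p : ℝ) / 2 + n / 2 + e + 1)
    {δ : SampleSpace p n → EuclideanSpace ℝ (Fin p)} (hδ : IsGeneralizedBayes (prior p a b e) δ) :
    δ =ᵐ[volume] shrinkageEstimator p n (phi p n a b e) := by
  filter_upwards [ae_snd_ne_zero hn, hδ.2] with y hy ⟨_, _, _, hmin⟩
  obtain ⟨Q, c, hQ, hc, hloss⟩ := exists_posteriorLoss_prior_eq hA hb he hy
  have hle := hmin (shrinkageEstimator p n (phi p n a b e) y)
  rw [hloss, hloss, sub_self, norm_zero, zero_pow two_ne_zero, mul_zero, add_zero,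
    ENNReal.ofReal_le_ofReal_iff hQ, add_le_iff_nonpos_right] at hle
  have hdist : ‖δ y - shrinkageEstimator p n (phi p n a b e) y‖ ^ 2 = 0 :=
    le_antisymm (nonpos_of_mul_nonpos_right hle hc) (sq_nonneg _)
  exact sub_eq_zero.1 (norm_eq_zero.1 (pow_eq_zero_iff two_ne_zero |>.1 hdist))

end HierarchicalPrior

section PriorParameters

variable {p n : ℕ} {a b e : ℝ}

theorem exponent_sub_two_sub (p n : ℕ) (a e : ℝ) :
    (p : ℝ) / 2 + n / 2 + e + 2 - 2 - (p / 2 + a) = n / 2 + e - a := by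
  ring

theorem alpha_pos (hA : -1 < (p : ℝ) / 2 + a) (hD : 0 < (n : ℝ) / 2 + e - a) :
    0 < alpha p n a e :=
  div_pos (by linarith) hD

theorem cBound_pos (hp : 3 ≤ p) (n : ℕ) : 0 < cBound p n := by
  have hp' : (3 : ℝ) ≤ p := by exact_mod_cast hp
  exact div_pos (by linarith) (by positivity)

theorem alpha_denom_pos_and_alpha_le_cBound (hp : 3 ≤ p) (hA : -1 < (p : ℝ) / 2 + a)
    (ha : a ≤ (cBound p n * ((n : ℝ) / 2 + e) - (p : ℝ) / 2 - 1) / (1 + cBound p n)) :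
    0 < (n : ℝ) / 2 + e - a ∧ alpha p n a e ≤ cBound p n := by
  have hc := cBound_pos hp n
  rw [le_div_iff₀ (by linarith)] at ha
  have hle : (p : ℝ) / 2 + a + 1 ≤ cBound p n * (n / 2 + e - a) := by linarith
  have hD : 0 < (n : ℝ) / 2 + e - a := pos_of_mul_pos_right (by linarith) hc.le
  exact ⟨hD, (div_le_iff₀ hD).2 hle⟩

theorem neg_one_lt_exponent_bound (hA : -1 < (p : ℝ) / 2 + a) (hα : 0 < alpha p n a e) :
    -1 < -((n : ℝ) + 2) * ((cBound p n - alpha p n a e) /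
      (4 * ((p : ℝ) + a + 1) * (alpha p n a e + 1))) := by
  have hp : (p : ℝ) / 2 < p + a + 1 := by linarith
  have hp' : 0 < (p : ℝ) + a + 1 := (by positivity : (0 : ℝ) ≤ p / 2).trans_lt hp
  rw [neg_mul, neg_lt_neg_iff, ← mul_div_assoc, div_lt_one (by positivity), mul_sub,
    add_two_mul_cBound]
  have hnα : 0 < ((n : ℝ) + 2) * alpha p n a e := by positivity
  have hpα : 0 < ((p : ℝ) + a + 1) * alpha p n a e := by positivity
  linarith

theorem monotoneOn_phi (hA : -1 < (p : ℝ) / 2 + a) (hb : -1 < b)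
    (hb' : min ((n : ℝ) / 2 + e - a - 1) 0 ≤ b) (hD : 0 < (n : ℝ) / 2 + e - a) :
    MonotoneOn (phi p n a b e) (Ioi 0) := by
  rw [phi_eq_hyperPhi]
  refine monotoneOn_hyperPhi hA hb ?_ (by rwa [exponent_sub_two_sub])
  convert hb' using 2
  ring

theorem not_antitoneOn_phi (n : ℕ) (e : ℝ) (hA : -1 < (p : ℝ) / 2 + a) (hb : -1 < b) :
    ¬ AntitoneOn (phi p n a b e) (Ioi 0) := by
  rw [phi_eq_hyperPhi]
  exact not_antitoneOn_hyperPhi hA hb _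

theorem not_monotoneOn_phi (hA : -1 < (p : ℝ) / 2 + a) (hb : -1 < b)
    (hb' : b < min 0 ((n : ℝ) / 2 + e - a - 1)) : ¬ MonotoneOn (phi p n a b e) (Ioi 0) := by
  obtain ⟨hb_neg, hbD⟩ := lt_min_iff.1 hb'
  rw [phi_eq_hyperPhi]
  exact not_monotoneOn_hyperPhi hA hb hb_neg (by linarith)

theorem tendsto_phi (hA : -1 < (p : ℝ) / 2 + a) (hb : -1 < b) (hD : 0 < (n : ℝ) / 2 + e - a) :
    Tendsto (phi p n a b e) atTop (𝓝 (alpha p n a e)) := by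
  rw [phi_eq_hyperPhi, alpha, ← exponent_sub_two_sub]
  exact tendsto_hyperPhi hA hb (by rwa [exponent_sub_two_sub])

theorem mul_phi_le_of_monotoneOn (hA : -1 < (p : ℝ) / 2 + a) (hb : -1 < b)
    (hD : 0 < (n : ℝ) / 2 + e - a) (hα : alpha p n a e ≤ cBound p n)
    (hmono : MonotoneOn (phi p n a b e) (Ioi 0)) {w : ℝ} (hw : 0 < w) :
    (n + 2) * (phi p n a b e w * (phi p n a b e w - cBound p n)) ≤
      4 * (w * deriv (phi p n a b e) w) * (1 + phi p n a b e w) := by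
  rw [phi_eq_hyperPhi] at hmono ⊢
  rw [alpha, ← exponent_sub_two_sub] at hα
  exact mul_hyperPhi_le_of_monotoneOn hA hb (by rwa [exponent_sub_two_sub]) hmono (by positivity)
    hα hw

theorem mul_phi_le_of_exponent_bound_le (hp : 3 ≤ p) (hA : -1 < (p : ℝ) / 2 + a) (hb : -1 < b)
    (hb_nonpos : b ≤ 0) (hD : 0 < (n : ℝ) / 2 + e - a)
    (hb' : -((n : ℝ) + 2) * ((cBound p n - alpha p n a e) /
      (4 * ((p : ℝ) + a + 1) * (alpha p n a e + 1))) ≤ b) {w : ℝ} (hw : 0 < w) :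
    (n + 2) * (phi p n a b e w * (phi p n a b e w - cBound p n)) ≤
      4 * (w * deriv (phi p n a b e) w) * (1 + phi p n a b e w) := by
  have hα := alpha_pos hA hD
  have hpa : 0 < (p : ℝ) + a + 1 := by linarith [(p.cast_nonneg : (0 : ℝ) ≤ p)]
  rw [neg_mul, ← mul_div_assoc, neg_le, le_div_iff₀ (by positivity)] at hb'
  rw [phi_eq_hyperPhi]
  refine mul_hyperPhi_le_of_le hA hb hb_nonpos (by rwa [exponent_sub_two_sub]) (by positivity)
    (cBound_pos hp n).le ?_ hw
  rw [exponent_sub_two_sub, ← alpha, add_two_mul_cBound]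
  linarith

theorem IsGeneralizedBayes.isMinimax (hp : 1 ≤ p) (hn : 1 ≤ n) (hA : -1 < (p : ℝ) / 2 + a)
    (hb : -1 < b) (hD : 0 < (n : ℝ) / 2 + e - a)
    (hineq : ∀ w, 0 < w → (n + 2) * (phi p n a b e w * (phi p n a b e w - cBound p n)) ≤
      4 * (w * deriv (phi p n a b e) w) * (1 + phi p n a b e w))
    {δ : SampleSpace p n → EuclideanSpace ℝ (Fin p)}
    (hδ : IsGeneralizedBayes (prior p a b e) δ) : IsMinimax δ := by
  have hδφ := hδ.ae_eq_shrinkageEstimator hn hA hb (by linarith)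
  rw [phi_eq_hyperPhi] at hδφ hineq
  exact isMinimax_of_ae_eq_shrinkageEstimator hp hn hA hb (by rwa [exponent_sub_two_sub]) hineq
    hδ.1 hδφ

end PriorParameters

end GenBayes

open GenBayes in
theorem mainTheorem3 (p n : ℕ) (hp : 3 ≤ p) (hn : 1 ≤ n) (a b e : ℝ)
    (he : -(p : ℝ) / 2 - (n : ℝ) / 2 - 1 < e) :
    (-(p : ℝ) / 2 - 1 < a →
      a ≤ (cBound p n * ((n : ℝ) / 2 + e) - (p : ℝ) / 2 - 1) / (1 + cBound p n) →
      min ((n : ℝ) / 2 + e - a - 1) 0 ≤ b →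
        IsGeneralizedBayes (prior p a b e) (shrinkageEstimator p n (phi p n a b e)) ∧
        (∀ δ : EuclideanSpace ℝ (Fin p) × EuclideanSpace ℝ (Fin n) → EuclideanSpace ℝ (Fin p),
          IsGeneralizedBayes (prior p a b e) δ →
            δ =ᵐ[MeasureTheory.volume] shrinkageEstimator p n (phi p n a b e) ∧ IsMinimax δ) ∧
        MonotoneOn (phi p n a b e) (Set.Ioi 0)) ∧
    (-(p : ℝ) / 2 - 1 < a →
      a < (cBound p n * ((n : ℝ) / 2 + e) - (p : ℝ) / 2 - 1) / (1 + cBound p n) →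
      -((n : ℝ) + 2) * ((cBound p n - alpha p n a e) /
          (4 * ((p : ℝ) + a + 1) * (alpha p n a e + 1))) ≤ b →
      b < min 0 ((n : ℝ) / 2 + e - a - 1) →
        -1 < -((n : ℝ) + 2) * ((cBound p n - alpha p n a e) /
          (4 * ((p : ℝ) + a + 1) * (alpha p n a e + 1))) ∧
        IsGeneralizedBayes (prior p a b e) (shrinkageEstimator p n (phi p n a b e)) ∧
        (∀ δ : EuclideanSpace ℝ (Fin p) × EuclideanSpace ℝ (Fin n) → EuclideanSpace ℝ (Fin p),
          IsGeneralizedBayes (prior p a b e) δ →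
            δ =ᵐ[MeasureTheory.volume] shrinkageEstimator p n (phi p n a b e) ∧ IsMinimax δ) ∧
        Filter.Tendsto (phi p n a b e) Filter.atTop (nhds (alpha p n a e)) ∧
        ¬ MonotoneOn (phi p n a b e) (Set.Ioi 0) ∧
        ¬ AntitoneOn (phi p n a b e) (Set.Ioi 0)) := by
  have he' : 0 < (p : ℝ) / 2 + n / 2 + e + 1 := by linarith
  refine ⟨fun ha ha' hb => ?_, fun ha ha' hb hb' => ?_⟩ <;>
    have hA : -1 < (p : ℝ) / 2 + a := by linarith
  · obtain ⟨hD, hα⟩ := alpha_denom_pos_and_alpha_le_cBound hp hA ha'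
    have hb₁ : -1 < b := (lt_min (by linarith) neg_one_lt_zero).trans_le hb
    have hmono := monotoneOn_phi hA hb₁ hb hD
    exact ⟨isGeneralizedBayes_shrinkageEstimator hn hA hb₁ he',
      fun δ hδ => ⟨hδ.ae_eq_shrinkageEstimator hn hA hb₁ he',
        hδ.isMinimax (by lia) hn hA hb₁ hD fun w => mul_phi_le_of_monotoneOn hA hb₁ hD hα hmono⟩,
      hmono⟩
  · obtain ⟨hD, -⟩ := alpha_denom_pos_and_alpha_le_cBound hp hA ha'.le
    have hbound := neg_one_lt_exponent_bound (n := n) hA (alpha_pos hA hD)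
    have hb₁ : -1 < b := hbound.trans_le hb
    have hb_nonpos : b ≤ 0 := (hb'.trans_le (min_le_left _ _)).le
    exact ⟨hbound, isGeneralizedBayes_shrinkageEstimator hn hA hb₁ he',
      fun δ hδ => ⟨hδ.ae_eq_shrinkageEstimator hn hA hb₁ he',
        hδ.isMinimax (by lia) hn hA hb₁ hD fun w =>
          mul_phi_le_of_exponent_bound_le hp hA hb₁ hb_nonpos hD hb⟩,
      tendsto_phi hA hb₁ hD, not_monotoneOn_phi hA hb₁ hb', not_antitoneOn_phi n e hA hb₁⟩
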